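/- Let $X_1,Y_1$ be non-negative random variables, $a_i=\mathbf E X_1^i$, $b_j=\mathbf E Y_1^j$, and let $c,x>0$, $\varkappa>2$. The law of a non-negative random variable $Z$ has property $\mathcal A_{c,\varkappa}$ if either $Z$ is integer valued and $\mathbf P(Z=r)=(1+o(1))c\,r^{-\varkappa}$ as $r\to\infty$, or $Z$ has a density $f_Z$ with $f_Z(t)=(c+o(1))t^{-\varkappa}$ as $t\to+\infty$. Notation. Let $\Lambda_3$ be mixed Poisson with random mean $Y_1a_2b_1$, and put $\tilde p(r)=r\,\mathbf P(\Lambda_3=r)/\mathbf E\Lambda_3$, $p_\infty(k_1,k_2)=\tilde p(k_1+1)\tilde p(k_2+1)$. For $\beta\in(0,\infty)$ let $\Lambda_0$ be mixed Poisson with random mean $X_1b_1\beta^{-1/2}$; let $\tau_1,\tau_2,\dots$ be i.i.d. with $\mathbf P(\tau_1=r)=\frac{r+1}{\mathbf E\Lambda_0}\mathbf P(\Lambda_0=r+1)$, $r\ge0$; for $y\ge 0$ let $d^*_y=\sum_{j=1}^{N_y}\tau_j$, where $N_y$ is Poisson with mean $ya_1\beta^{1/2}$, independent of $(\tau_j)$;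 put $q_r=\mathbf E\bigl(Y_1\,\mathbf P(d^*_{Y_1}=r\mid Y_1)\bigr)$ and $$S_\beta(k_1,k_2)=\sum_{r=0}^{k_1\wedge k_2}(r+1)(r+2)\mathbf P(\Lambda_0=r+2)\,q_{k_1-r}q_{k_2-r},\qquad p_\beta(k_1,k_2)=\frac{\beta}{b_1^4a_2}S_\beta(k_1,k_2),$$ where $p_\beta$ is considered when $a_2<\infty$. (i) Assume that $\mathbf E X_1^2<\infty$, $X_1$ is not almost surely $0$, and the law of $Y_1$ has property $\mathcal A_{c,\varkappa}$. Then, as $k_1,k_2\to+\infty$, $$p_\infty(k_1,k_2)=(1+o(1))\,c^2a_2^{2\varkappa-4}b_1^{2\varkappa-6}(k_1k_2)^{1-\varkappa}.$$ (ii) Let $\beta\in(0,\infty)$. Assume that $\mathbf E e^{aY_1}<\infty$ for some $a>0$, $Y_1$ is not almost surely $0$, and the law of $X_1$ has property $\mathcal A_{c,\varkappa}$. Put $c_1^*=c(b_1\beta^{-1/2})^{\varkappa-1}$, $c_2^*=cb_1^{\varkappa-2}b_2\beta^{(3-\varkappa)/2}$ and, for each integer $k\ge0$, $c^*_{3,k}=\sum_{i\ge0}q_iq_{k+i}$;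 this series converges. Then $q_r=(1+o(1))c_2^*r^{1-\varkappa}$ as $r\to\infty$. If $k_1\le k_2$, $k_1\to+\infty$ and either $k_2-k_1\to+\infty$ or $k_2-k_1=k$ for a fixed integer $k\ge0$, then $$S_\beta(k_1,k_2)=(1+o(1))\begin{cases} b_1c_1^*c_2^*\,k_1^{2-\varkappa}(k_2-k_1)^{1-\varkappa}&\text{if }k_2-k_1\to+\infty,\\ c_1^*c_{3,k}^*\,k_1^{2-\varkappa}&\text{if }k_2-k_1=k,\end{cases}$$ and hence, when $a_2<\infty$, $$p_\beta(k_1,k_2)=(1+o(1))\frac{\beta}{b_1^4a_2}\begin{cases} b_1c_1^*c_2^*\,k_1^{2-\varkappa}(k_2-k_1)^{1-\varkappa}&\text{if }k_2-k_1\to+\infty,\\ c_1^*c_{3,k}^*\,k_1^{2-\varkappa}&\text{if }k_2-k_1=k.\end{cases}$$ (iii) Let $\beta\in(0,\infty)$. Assume that $\mathbf P(X_1=x)=1$ and the law of $Y_1$ has property $\mathcal A_{c,\varkappa}$. Then, as $k_1,k_2\to+\infty$, $$p_\beta(k_1,k_2)=(1+o(1))\,c^2x^{4\varkappa-8}b_1^{2\varkappa-6}(k_1k_2)^{1-\varkappa}.$$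 -/

import Mathlib

open MeasureTheory Filter Asymptotics Topology

noncomputable section

namespace Affiliation

/-- The moment `E Z ^ i` of a random variable `Z` with law `P`. -/
def moment (P : Measure ℝ) (i : ℕ) : ℝ := ∫ z, z ^ i ∂P

/-- The Poisson probability `e ^ (-l) l ^ r / r!`. -/
def poissonProb (l : ℝ) (r : ℕ) : ℝ := Real.exp (-l) * l ^ r / (r.factorial : ℝ)

/-- `P(Λ = r)` for a mixed Poisson variable `Λ` with random mean `s * Z`, where `Z` has law `P`. -/
def mixedPoisson (P : Measure ℝ) (s : ℝ) (r : ℕ) : ℝ := ∫ z, poissonProb (s * z) r ∂P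

/-- The mean of a distribution on `ℕ` given by its probabilities. -/
def meanOf (f : ℕ → ℝ) : ℝ := ∑' r : ℕ, (r : ℝ) * f r

/-- The law of a non-negative random variable has the property `A_{c,κ}`: either it is carried by
the integers and `P(Z = r)` is equivalent to `c r ^ (-κ)`, or it has a density `f` with
`f t = (c + o(1)) t ^ (-κ)` as `t → ∞`. -/
def PropertyA (P : Measure ℝ) (c κ : ℝ) : Prop :=
  ((∀ᵐ z ∂P, ∃ r : ℕ, z = (r : ℝ)) ∧
    (fun r : ℕ => P.real ({(r : ℝ)} : Set ℝ)) ~[atTop] (fun r : ℕ => c * (r : ℝ) ^ (-κ))) ∨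
  (∃ f : ℝ → ℝ, Measurable f ∧ (∀ t, 0 ≤ f t) ∧
    P = volume.withDensity (fun t => ENNReal.ofReal (f t)) ∧
    f ~[atTop] (fun t : ℝ => c * t ^ (-κ)))

/-- `P(τ_1 + ... + τ_N = r)` for independent variables `τ_j` on `ℕ` with `P(τ_j = r) = f r`. -/
def convPow (f : ℕ → ℝ) : ℕ → ℕ → ℝ
  | 0 => fun r => if r = 0 then 1 else 0
  | N + 1 => fun r => ∑ i ∈ Finset.range (r + 1), convPow f N i * f (r - i)

/-- `P(Λ_0 = r)`, where `Λ_0` is mixed Poisson with random mean `X b_1 β ^ (-1/2)`. -/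
def probLam0 (P₁ P₂ : Measure ℝ) (β : ℝ) (r : ℕ) : ℝ :=
  mixedPoisson P₁ (moment P₂ 1 * β ^ (-(1 / 2 : ℝ))) r

/-- `P(Λ_3 = r)`, where `Λ_3` is mixed Poisson with random mean `Y a_2 b_1`. -/
def probLam3 (P₁ P₂ : Measure ℝ) (r : ℕ) : ℝ :=
  mixedPoisson P₂ (moment P₁ 2 * moment P₂ 1) r

/-- `P(τ_1 = r) = (r + 1) P(Λ_0 = r + 1) / E Λ_0`. -/
def probTau (P₁ P₂ : Measure ℝ) (β : ℝ) (r : ℕ) : ℝ :=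
  ((r : ℝ) + 1) / meanOf (probLam0 P₁ P₂ β) * probLam0 P₁ P₂ β (r + 1)

/-- `P(d*_y = r) = P(d_* = r | Y = y)`: the compound Poisson probability
`P(τ_1 + ... + τ_N = r)`, where `N` is Poisson with mean `y a_1 β ^ (1/2)`, independent of the
`τ_j`. -/
def probDstar (P₁ P₂ : Measure ℝ) (β y : ℝ) (r : ℕ) : ℝ :=
  ∑' N : ℕ, poissonProb (y * moment P₁ 1 * β ^ (1 / 2 : ℝ)) N * convPow (probTau P₁ P₂ β) N r

/-- `q_r = E (Y P(d_* = r | Y))`. -/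
def q (P₁ P₂ : Measure ℝ) (β : ℝ) (r : ℕ) : ℝ := ∫ y, y * probDstar P₁ P₂ β y r ∂P₂

/-- The sum `∑_{r ≤ k₁ ∧ k₂} (r+1)(r+2) P(Λ_0 = r+2) q_{k₁-r} q_{k₂-r}`. -/
def degSum (P₁ P₂ : Measure ℝ) (β : ℝ) (k₁ k₂ : ℕ) : ℝ :=
  ∑ r ∈ Finset.range (min k₁ k₂ + 1),
    ((r : ℝ) + 1) * ((r : ℝ) + 2) * probLam0 P₁ P₂ β (r + 2) *
      q P₁ P₂ β (k₁ - r) * q P₁ P₂ β (k₂ - r)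

/-- The limiting degree-degree distribution `p_β` for `m / n → β ∈ (0, ∞)`. -/
def pBeta (P₁ P₂ : Measure ℝ) (β : ℝ) (k₁ k₂ : ℕ) : ℝ :=
  β / (moment P₂ 1 ^ 4 * moment P₁ 2) * degSum P₁ P₂ β k₁ k₂

/-- The size-biased distribution `r P(Λ_3 = r) / E Λ_3`. -/
def pTilde (P₁ P₂ : Measure ℝ) (r : ℕ) : ℝ :=
  (r : ℝ) * probLam3 P₁ P₂ r * (meanOf (probLam3 P₁ P₂))⁻¹

/-- The limiting degree-degree distribution `p_∞` for `m / n → ∞`. -/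
def pInfty (P₁ P₂ : Measure ℝ) (k₁ k₂ : ℕ) : ℝ :=
  pTilde P₁ P₂ (k₁ + 1) * pTilde P₁ P₂ (k₂ + 1)

/-- `c*_1 = c (b_1 β ^ (-1/2)) ^ (κ-1)`. -/
def cStar1 (P₂ : Measure ℝ) (β c κ : ℝ) : ℝ := c * (moment P₂ 1 * β ^ (-(1 / 2 : ℝ))) ^ (κ - 1)

/-- `c*_2 = c b_1 ^ (κ-2) b_2 β ^ ((3-κ)/2)`. -/
def cStar2 (P₂ : Measure ℝ) (β c κ : ℝ) : ℝ :=
  c * moment P₂ 1 ^ (κ - 2) * moment P₂ 2 * β ^ ((3 - κ) / 2)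

/-- `c*_{3,k} = ∑_{i ≥ 0} q_i q_{k+i}`. -/
def cStar3 (P₁ P₂ : Measure ℝ) (β : ℝ) (k : ℕ) : ℝ :=
  ∑' i : ℕ, q P₁ P₂ β i * q P₁ P₂ β (k + i)

end Affiliation

end

open Affiliation

/-!
All the asymptotics are statements about sequences with a power tail, `f r ∼ L r ^ (-a)`, and two
mechanisms produce them.

*Poisson mixtures preserve power tails.* If the mixing weights are `∼ c t ^ (-κ)`, then the mixture
of the Poisson laws of mean `s t` is `∼ c s ^ (κ - 1) r ^ (-κ)` (`powTail_mixture`). Against the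
exact power this is the Gamma integral `s ^ (κ - 1) Γ (r + 1 - κ) / r!`. A sum over the integers
differs from that integral by at most the total variation of `t ^ (r - κ) e ^ (-s t)`, whose ratio
to the integral is at most `s / √(r - κ - 1)` (`abs_tsum_rpow_mul_exp_sub_le`). Hence both
alternatives of property `A_{c,κ}` give the same tail for a mixed Poisson variable, which is all that
part (i) needs.

*One large summand carries a heavy-tailed sum.* The convolution of two summable power tails is
computed by dominated convergence on each half of the range (`PowTail.conv`). One of `N` summands
is at least the `N`-th part of the sum, so that the `N`-fold convolution exceeds the tail of one
summand by a factor polynomial in `N` only (`exists_convPow_bound`). An exponential moment of `Y`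
makes all polynomial moments of the random number of summands finite, so the limit can be taken under
the compound Poisson sum (`powTail_q_of_exp`). In the sum `S_β` the factor
`(r + 1)(r + 2) P(Λ₀ = r + 2)` has a tail of exponent `κ - 2 > 0` and need not be summable; it does
tend to zero, and a Cesàro average removes the terms in which `k₁ - r`, the index of `q`, is large
(`tendsto_degree_sum`).

For a constant `X` the jumps `τ` are Poisson, and a sum of `N` of them is Poisson with mean
proportional to `N`. So `q` is a Poisson mixture over the integers with weights
`E (Y P(N_Y = N | Y))`, which form a Poisson mixture themselves, and the first mechanism applies twice
(`powTail_q_dirac`). The remaining sum has Poisson weights in `r`, which decay fast enough to replace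
`q (k₁ - r) q (k₂ - r)` by `q k₁ q k₂` (`tendsto_light_sum`).
-/

noncomputable section

namespace Affiliation

/-! ### Sequences with a power tail -/

/-- `PowTail f a L` says that `f r ∼ L r ^ (-a)` as `r → ∞`, where `L = 0` is allowed and means
`f r = o(r ^ (-a))`. The shift in `(r + 1) ^ a` makes the normalizing factor positive at every
`r`, so that a power tail gives a bound valid for all `r`. -/
def PowTail (f : ℕ → ℝ) (a L : ℝ) : Prop :=
  Tendsto (fun r : ℕ => f r * ((r : ℝ) + 1) ^ a) atTop (𝓝 L)

lemma tendsto_shift_ratio_rpow (j : ℕ) (a : ℝ) :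
    Tendsto (fun r : ℕ => ((((r + j : ℕ) : ℝ) + 1) / ((r : ℝ) + 1)) ^ a) atTop (𝓝 1) := by
  have h := tendsto_add_mul_div_add_mul_atTop_nhds ((j : ℝ) + 1) 1 1 (d := (1 : ℝ)) one_ne_zero
  have h2 : Tendsto (fun r : ℕ => (((r + j : ℕ) : ℝ) + 1) / ((r : ℝ) + 1)) atTop (𝓝 1) := by
    rw [div_one] at h
    refine h.congr fun r => ?_
    push_cast
    congr 1 <;> ring
  simpa using h2.rpow_const (p := a) (Or.inl one_ne_zero)

lemma PowTail.tendsto_sub {f : ℕ → ℝ} {a L : ℝ} (h : PowTail f a L) (j : ℕ) :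
    Tendsto (fun r : ℕ => f (r - j) * ((r : ℝ) + 1) ^ a) atTop (𝓝 L) := by
  rw [← tendsto_add_atTop_iff_nat j]
  have := h.mul (tendsto_shift_ratio_rpow j a)
  rw [mul_one] at this
  refine this.congr fun r => ?_
  rw [Real.div_rpow (by positivity) (by positivity), Nat.add_sub_cancel]
  have : ((r : ℝ) + 1) ^ a ≠ 0 := by positivity
  field_simp

lemma PowTail.shift {f : ℕ → ℝ} {a L : ℝ} (h : PowTail f a L) (j : ℕ) :
    PowTail (fun r => f (r + j)) a L := by
  have h1 := (tendsto_add_atTop_iff_nat j).mpr h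
  have := h1.mul (tendsto_shift_ratio_rpow j (-a))
  rw [mul_one] at this
  refine this.congr fun r => ?_
  rw [Real.div_rpow (by positivity) (by positivity), Real.rpow_neg (by positivity),
    Real.rpow_neg (by positivity)]
  have : (((r + j : ℕ) : ℝ) + 1) ^ a ≠ 0 := by positivity
  field_simp

lemma PowTail.const_mul {f : ℕ → ℝ} {a L : ℝ} (h : PowTail f a L) (c : ℝ) :
    PowTail (fun r => c * f r) a (c * L) := by
  refine (Tendsto.const_mul c h).congr fun r => by ring

lemma PowTail.succ_mul {f : ℕ → ℝ} {a L : ℝ} (h : PowTail f a L) :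
    PowTail (fun r => ((r : ℝ) + 1) * f r) (a - 1) L := by
  refine Tendsto.congr (fun r => ?_) h
  have : ((r : ℝ) + 1) ≠ 0 := by positivity
  rw [Real.rpow_sub_one this]
  field_simp

lemma PowTail.bound {f : ℕ → ℝ} {a L : ℝ} (h : PowTail f a L) :
    ∃ C : ℝ, 1 ≤ C ∧ ∀ r : ℕ, |f r| ≤ C * ((r : ℝ) + 1) ^ (-a) := by
  obtain ⟨C, hC⟩ := (Metric.isBounded_range_of_tendsto _ h).exists_norm_le
  refine ⟨max C 1, le_max_right _ _, fun r => ?_⟩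
  have h1 := (hC _ ⟨r, rfl⟩).trans (le_max_left C 1)
  have hp : (0 : ℝ) < ((r : ℝ) + 1) ^ a := by positivity
  simp only [norm_mul, Real.norm_eq_abs, abs_of_pos hp] at h1
  rw [Real.rpow_neg (by positivity), ← div_eq_mul_inv, le_div_iff₀ hp]
  exact h1

lemma summable_succ_rpow_neg {a : ℝ} (ha : 1 < a) :
    Summable (fun r : ℕ => ((r : ℝ) + 1) ^ (-a)) := by
  have := (summable_nat_add_iff (f := fun n : ℕ => (n : ℝ) ^ (-a)) 1).mpr
    (Real.summable_nat_rpow.mpr (by linarith))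
  simpa using this

lemma PowTail.summable_abs {f : ℕ → ℝ} {a L : ℝ} (h : PowTail f a L) (ha : 1 < a) :
    Summable (fun r => |f r|) := by
  obtain ⟨C, -, hC⟩ := h.bound
  exact Summable.of_nonneg_of_le (fun _ => abs_nonneg _) hC
    ((summable_succ_rpow_neg ha).mul_left C)

lemma PowTail.tendsto_zero {f : ℕ → ℝ} {a L : ℝ} (h : PowTail f a L) (ha : 0 < a) :
    Tendsto f atTop (𝓝 0) := by
  have h1 : Tendsto (fun r : ℕ => ((r : ℝ) + 1) ^ (-a)) atTop (𝓝 0) :=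
    (tendsto_rpow_neg_atTop ha).comp
      (tendsto_atTop_add_const_right _ 1 tendsto_natCast_atTop_atTop)
  have h2 := Tendsto.mul h h1
  rw [mul_zero] at h2
  refine h2.congr fun r => ?_
  have : (0 : ℝ) < ((r : ℝ) + 1) ^ a := by positivity
  rw [Real.rpow_neg (by positivity)]
  field_simp

lemma tendsto_natCast_ratio_rpow (a : ℝ) :
    Tendsto (fun r : ℕ => (((r : ℝ) + 1) / (r : ℝ)) ^ a) atTop (𝓝 1) := by
  have h := tendsto_add_mul_div_add_mul_atTop_nhds (1 : ℝ) 0 1 (d := (1 : ℝ)) one_ne_zero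
  have h2 : Tendsto (fun r : ℕ => ((r : ℝ) + 1) / (r : ℝ)) atTop (𝓝 1) := by
    rw [div_one] at h
    refine h.congr fun r => ?_
    congr 1 <;> ring
  simpa using h2.rpow_const (p := a) (Or.inl one_ne_zero)

lemma powTail_iff {f : ℕ → ℝ} {a L : ℝ} :
    PowTail f a L ↔ Tendsto (fun r : ℕ => f r * (r : ℝ) ^ a) atTop (𝓝 L) := by
  constructor
  · intro h
    have := Tendsto.mul h (tendsto_natCast_ratio_rpow (-a))
    rw [mul_one] at this
    refine this.congr' ?_
    filter_upwards [eventually_gt_atTop 0] with r hr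
    have hr' : (0 : ℝ) < r := by exact_mod_cast hr
    rw [Real.div_rpow (by positivity) (by positivity), Real.rpow_neg (by positivity),
      Real.rpow_neg (by positivity)]
    have : ((r : ℝ) + 1) ^ a ≠ 0 := by positivity
    field_simp
  · intro h
    have := Tendsto.mul h (tendsto_natCast_ratio_rpow a)
    rw [mul_one] at this
    refine this.congr' ?_
    filter_upwards [eventually_gt_atTop 0] with r hr
    have hr' : (0 : ℝ) < r := by exact_mod_cast hr
    rw [Real.div_rpow (by positivity) (by positivity)]
    have : (r : ℝ) ^ a ≠ 0 := by positivity
    field_simp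

lemma isEquivalent_of_tendsto {ι : Type*} {l : Filter ι} {f g : ι → ℝ} {L : ℝ} (hL : L ≠ 0)
    (hg : ∀ᶠ x in l, g x ≠ 0) (h : Tendsto (fun x => f x / g x) l (𝓝 L)) :
    f ~[l] fun x => L * g x := by
  rw [isEquivalent_iff_tendsto_one (by filter_upwards [hg] with x hx using mul_ne_zero hL hx)]
  have := h.div_const L
  rw [div_self hL] at this
  refine this.congr fun x => ?_
  simp only [Pi.div_apply]
  rw [div_div, mul_comm (g x)]

lemma PowTail.isEquivalent {f : ℕ → ℝ} {a L : ℝ} (h : PowTail f a L) (hL : L ≠ 0) :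
    f ~[atTop] fun r : ℕ => L * (r : ℝ) ^ (-a) := by
  refine isEquivalent_of_tendsto hL ?_ ?_
  · filter_upwards [eventually_gt_atTop 0] with r hr
    have hr' : (0 : ℝ) < r := by exact_mod_cast hr
    positivity
  · refine (powTail_iff.mp h).congr fun r => ?_
    rw [Real.rpow_neg (by positivity), div_inv_eq_mul]

/-- Halving the argument costs only a constant factor in a power. -/
lemma half_rpow_bound {a : ℝ} (ha : 0 ≤ a) {k i : ℕ} (hi : 2 * i ≤ k) :
    (((k - i : ℕ) : ℝ) + 1) ^ (-a) * ((k : ℝ) + 1) ^ a ≤ 2 ^ a := by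
  have h1 : ((k : ℝ) + 1) ≤ 2 * (((k - i : ℕ) : ℝ) + 1) := by
    have : k + 1 ≤ 2 * ((k - i) + 1) := by omega
    exact_mod_cast this
  have h2 : (0 : ℝ) < (((k - i : ℕ) : ℝ) + 1) := by positivity
  rw [Real.rpow_neg h2.le, inv_mul_le_iff₀ (by positivity), mul_comm,
    ← Real.mul_rpow (by positivity) h2.le]
  exact Real.rpow_le_rpow (by positivity) h1 ha

/-- Dominated convergence for the half of a convolution in which the argument `k - i` of the
power-tailed factor `h` is large: there `h (k - i) (k + 1) ^ a` is bounded and tends to `H`. The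
predicate `p` marks the half; the other factor `w` and its length `k` may depend on a parameter. -/
lemma tendsto_half_sum {ι : Type*} {l : Filter ι} {k : ι → ℕ} (hk : Tendsto k l atTop)
    {h : ℕ → ℝ} {a H : ℝ} (ha : 0 ≤ a) (hh : PowTail h a H) {w : ι → ℕ → ℝ} {W B : ℕ → ℝ}
    (hB : Summable B) (hwB : ∀ᶠ x in l, ∀ i, |w x i| ≤ B i)
    (hw : ∀ i, Tendsto (fun x => w x i) l (𝓝 (W i)))
    (p : ι → ℕ → Prop) [∀ x i, Decidable (p x i)] (hp : ∀ x i, p x i → 2 * i ≤ k x)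
    (hp' : ∀ i, ∀ᶠ x in l, p x i) :
    Tendsto (fun x => (∑ i ∈ Finset.range (k x + 1), if p x i then h (k x - i) * w x i else 0) *
      ((k x : ℝ) + 1) ^ a) l (𝓝 (H * ∑' i, W i)) := by
  obtain ⟨C, hC1, hC⟩ := hh.bound
  have key : Tendsto (fun x => ∑' i, (if p x i then h (k x - i) * w x i else 0) *
      ((k x : ℝ) + 1) ^ a) l (𝓝 (∑' i, H * W i)) := by
    refine tendsto_tsum_of_dominated_convergence (bound := fun i => C * 2 ^ a * B i)
      (hB.mul_left _) (fun i => ?_) ?_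
    · have h1 : Tendsto (fun x => h (k x - i) * ((k x : ℝ) + 1) ^ a) l (𝓝 H) :=
        (hh.tendsto_sub i).comp hk
      refine (h1.mul (hw i)).congr' ?_
      filter_upwards [hp' i] with x hx
      rw [if_pos hx]; ring
    · filter_upwards [hwB] with x hx i
      have hBi : 0 ≤ B i := (abs_nonneg _).trans (hx i)
      split_ifs with hpi
      · have h3 : (0 : ℝ) < ((k x : ℝ) + 1) ^ a := by positivity
        rw [norm_mul, norm_mul, Real.norm_eq_abs, Real.norm_eq_abs, Real.norm_eq_abs,
          abs_of_pos h3]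
        calc |h (k x - i)| * |w x i| * ((k x : ℝ) + 1) ^ a
            ≤ (C * (((k x - i : ℕ) : ℝ) + 1) ^ (-a)) * B i * ((k x : ℝ) + 1) ^ a := by
              gcongr
              · exact hC _
              · exact hx i
          _ = C * ((((k x - i : ℕ) : ℝ) + 1) ^ (-a) * ((k x : ℝ) + 1) ^ a) * B i := by ring
          _ ≤ C * 2 ^ a * B i := by
              gcongr
              exact half_rpow_bound ha (hp x i hpi)
      · simp only [zero_mul, norm_zero]
        positivity
  rw [tsum_mul_left] at key
  refine key.congr fun x => ?_
  rw [tsum_mul_right]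
  congr 1
  refine tsum_eq_sum fun i hi => if_neg fun h' => hi ?_
  have := hp x i h'
  rw [Finset.mem_range]
  omega

lemma eventually_two_mul_lt {ι : Type*} {l : Filter ι} {k : ι → ℕ} (hk : Tendsto k l atTop)
    (i : ℕ) : ∀ᶠ x in l, 2 * i < k x := hk.eventually_gt_atTop (2 * i)

/-- Splits a sum over `i ≤ k` into `2 i ≤ k` and, in terms of `j = k - i`, `2 j < k`. -/
lemma sum_range_split_half (k : ℕ) (F : ℕ → ℝ) :
    ∑ i ∈ Finset.range (k + 1), F i =
      (∑ i ∈ Finset.range (k + 1), if 2 * i ≤ k then F i else 0) +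
      ∑ j ∈ Finset.range (k + 1), if 2 * j < k then F (k - j) else 0 := by
  rw [← Finset.sum_range_reflect (fun j => if 2 * j < k then F (k - j) else 0),
    ← Finset.sum_add_distrib]
  refine Finset.sum_congr rfl fun i hi => ?_
  rw [Finset.mem_range] at hi
  have e : k + 1 - 1 - i = k - i := by omega
  have e2 : k - (k - i) = i := by omega
  rw [e, e2]
  by_cases h : 2 * i ≤ k
  · rw [if_pos h, if_neg (by omega), add_zero]
  · rw [if_neg h, if_pos (by omega), zero_add]

/-- The convolution of two sequences with summable power tails: one of the two summands carries
almost all of the total. -/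
lemma PowTail.conv {u v : ℕ → ℝ} {a U V : ℝ} (ha : 1 < a) (hu : PowTail u a U)
    (hv : PowTail v a V) :
    PowTail (fun r => ∑ i ∈ Finset.range (r + 1), u i * v (r - i)) a
      (V * ∑' i, u i + U * ∑' i, v i) := by
  have h1 := tendsto_half_sum (l := atTop) (k := fun r : ℕ => r) tendsto_id (by linarith) hv
    (w := fun _ i => u i) (W := u) (hu.summable_abs ha)
    (Eventually.of_forall fun _ _ => le_rfl) (fun _ => tendsto_const_nhds)
    (fun r i => 2 * i ≤ r) (fun _ _ h => h)
    (fun i => (eventually_two_mul_lt tendsto_id i).mono fun _ h => h.le)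
  have h2 := tendsto_half_sum (l := atTop) (k := fun r : ℕ => r) tendsto_id (by linarith) hu
    (w := fun _ i => v i) (W := v) (hv.summable_abs ha)
    (Eventually.of_forall fun _ _ => le_rfl) (fun _ => tendsto_const_nhds)
    (fun r i => 2 * i < r) (fun _ _ h => h.le) (fun i => eventually_two_mul_lt tendsto_id i)
  refine (h1.add h2).congr fun r => ?_
  beta_reduce
  rw [← add_mul, sum_range_split_half r (fun i => u i * v (r - i))]
  congr 2
  · exact Finset.sum_congr rfl fun i _ => by split_ifs <;> ring
  · refine Finset.sum_congr rfl fun i hi => ?_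
    split_ifs with h
    · rw [show r - (r - i) = i by omega]
    · rfl

/-- The sum behind the degree-degree distribution. The factor `h` need not be summable, but it
tends to zero, and a Cesàro average of `h` disposes of the half in which `k - i` is small. -/
lemma tendsto_degree_sum {ι : Type*} {l : Filter ι} {k : ι → ℕ} (hk : Tendsto k l atTop)
    {h q : ℕ → ℝ} {a H Q : ℝ} (ha : 0 < a) (hh : PowTail h a H) (hq : PowTail q (a + 1) Q)
    {g : ι → ℕ → ℝ} {G : ℕ → ℝ} {D : ℝ} (hgD : ∀ᶠ x in l, ∀ i, |g x i| ≤ D)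
    (hg : ∀ i, Tendsto (fun x => g x i) l (𝓝 (G i))) :
    Tendsto (fun x => (∑ i ∈ Finset.range (k x + 1), h (k x - i) * (q i * g x i)) *
      ((k x : ℝ) + 1) ^ a) l (𝓝 (H * ∑' i, q i * G i)) := by
  have h1 := tendsto_half_sum hk ha.le hh (w := fun x i => q i * g x i) (W := fun i => q i * G i)
    ((hq.summable_abs (by linarith)).mul_right D)
    (by
      filter_upwards [hgD] with x hx i
      rw [abs_mul]
      exact mul_le_mul_of_nonneg_left (hx i) (abs_nonneg _))
    (fun i => (hg i).const_mul _) (fun x i => 2 * i ≤ k x) (fun _ _ h => h)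
    (fun i => (eventually_two_mul_lt hk i).mono fun _ h => h.le)
  obtain ⟨C, hC1, hC⟩ := hq.bound
  have hces : Tendsto (fun x => ((k x : ℝ) + 1)⁻¹ *
      ∑ i ∈ Finset.range (k x + 1), |h i|) l (𝓝 0) := by
    have := (hh.tendsto_zero ha).abs.cesaro
    rw [abs_zero] at this
    refine ((this.comp (tendsto_add_atTop_nat 1)).comp hk).congr fun x => ?_
    simp
  have h2 : Tendsto (fun x => (∑ j ∈ Finset.range (k x + 1), if 2 * j < k x then
      h (k x - (k x - j)) * (q (k x - j) * g x (k x - j)) else 0) * ((k x : ℝ) + 1) ^ a) l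
      (𝓝 0) := by
    refine squeeze_zero_norm' ?_ (by simpa using hces.const_mul (C * 2 ^ (a + 1) * D))
    filter_upwards [hgD] with x hx
    have hD : 0 ≤ D := (abs_nonneg _).trans (hx 0)
    have h3 : (0 : ℝ) < ((k x : ℝ) + 1) ^ a := by positivity
    rw [norm_mul, Real.norm_eq_abs (_ ^ a), abs_of_pos h3]
    refine (mul_le_mul_of_nonneg_right (norm_sum_le _ _) h3.le).trans ?_
    rw [Finset.sum_mul, Finset.mul_sum, Finset.mul_sum]
    refine Finset.sum_le_sum fun j hj => ?_
    split_ifs with hjk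
    · rw [show k x - (k x - j) = j by omega, norm_mul, norm_mul]
      simp only [Real.norm_eq_abs]
      have h4 := half_rpow_bound (a := a + 1) (by linarith) hjk.le
      have h5 : ((k x : ℝ) + 1) ^ a = ((k x : ℝ) + 1)⁻¹ * ((k x : ℝ) + 1) ^ (a + 1) := by
        rw [Real.rpow_add_one (by positivity)]
        field_simp
      calc |h j| * (|q (k x - j)| * |g x (k x - j)|) * ((k x : ℝ) + 1) ^ a
          ≤ |h j| * ((C * (((k x - j : ℕ) : ℝ) + 1) ^ (-(a + 1))) * D) * ((k x : ℝ) + 1) ^ a := by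
            gcongr
            · exact hC _
            · exact hx _
        _ = C * ((((k x - j : ℕ) : ℝ) + 1) ^ (-(a + 1)) * ((k x : ℝ) + 1) ^ (a + 1)) * D *
              (((k x : ℝ) + 1)⁻¹ * |h j|) := by rw [h5]; ring
        _ ≤ C * 2 ^ (a + 1) * D * (((k x : ℝ) + 1)⁻¹ * |h j|) := by gcongr
    · rw [norm_zero, zero_mul]
      positivity
  have := h1.add h2
  rw [add_zero] at this
  refine this.congr fun x => ?_
  rw [← add_mul, ← sum_range_split_half (k x)
    (fun i => h (k x - i) * (q i * g x i))]

/-! ### Poisson probabilities -/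

lemma poissonProb_nonneg {l : ℝ} (hl : 0 ≤ l) (r : ℕ) : 0 ≤ poissonProb l r := by
  unfold poissonProb; positivity

lemma hasSum_poissonProb (l : ℝ) : HasSum (poissonProb l) 1 := by
  have h := (NormedSpace.expSeries_div_hasSum_exp l).mul_left (Real.exp (-l))
  rw [← Real.exp_eq_exp_ℝ, ← Real.exp_add, neg_add_cancel, Real.exp_zero] at h
  refine h.congr_fun fun r => ?_
  rw [poissonProb, mul_div_assoc]

lemma poissonProb_le_one {l : ℝ} (hl : 0 ≤ l) (r : ℕ) : poissonProb l r ≤ 1 :=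
  le_hasSum (hasSum_poissonProb l) r fun _ _ => poissonProb_nonneg hl _

lemma succ_mul_poissonProb (l : ℝ) (r : ℕ) :
    ((r : ℝ) + 1) * poissonProb l (r + 1) = l * poissonProb l r := by
  unfold poissonProb
  rw [Nat.factorial_succ]
  push_cast
  field_simp
  ring

lemma continuous_poissonProb (r : ℕ) : Continuous fun l => poissonProb l r := by
  unfold poissonProb; fun_prop

/-! ### The ratio of Gamma functions -/

lemma powTail_pow_div_factorial (z κ : ℝ) :
    PowTail (fun r => z ^ r / (r.factorial : ℝ)) κ 0 := by
  set n := ⌈|κ|⌉₊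
  refine squeeze_zero_norm (fun r => ?_)
    (FloorSemiring.tendsto_pow_div_factorial_atTop (2 ^ n * |z|))
  have h1 : ((r : ℝ) + 1) ^ κ ≤ (2 ^ n) ^ r := by
    calc ((r : ℝ) + 1) ^ κ ≤ ((r : ℝ) + 1) ^ (n : ℝ) :=
          Real.rpow_le_rpow_of_exponent_le (by simp) ((le_abs_self κ).trans (Nat.le_ceil _))
      _ = ((r : ℝ) + 1) ^ n := Real.rpow_natCast _ _
      _ ≤ (2 ^ r) ^ n := by
          gcongr
          exact_mod_cast Nat.lt_two_pow_self
      _ = (2 ^ n) ^ r := by rw [← pow_mul, ← pow_mul, mul_comm]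
  rw [norm_mul, norm_div, norm_pow, Real.norm_eq_abs, Real.norm_eq_abs, Real.norm_eq_abs,
    abs_of_pos (by positivity : (0 : ℝ) < ((r : ℝ) + 1) ^ κ), Nat.abs_cast, mul_pow,
    div_mul_eq_mul_div, mul_comm]
  gcongr

lemma Gamma_add_nat_eq_prod {x : ℝ} (hx : 0 < x) (n : ℕ) :
    Real.Gamma (x + n) = Real.Gamma x * ∏ j ∈ Finset.range n, (x + j) := by
  induction n with
  | zero => simp
  | succ n ih =>
    rw [Finset.prod_range_succ, ← mul_assoc, ← ih, Nat.cast_succ, ← add_assoc,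
      Real.Gamma_add_one (by positivity), mul_comm]

/-- Euler's limit formula gives the asymptotics of `Γ (r + 1 + x) / r!` for `x > 0`; the functional
equation carries them down to `x - m`, so that they hold for every real exponent. -/
lemma powTail_Gamma_sub {x : ℝ} (hx : 0 < x) (m : ℕ) :
    PowTail (fun r => Real.Gamma (r + 1 + (x - m)) / (r.factorial : ℝ)) (-(x - m)) 1 := by
  induction m with
  | zero =>
    rw [powTail_iff]
    have h := (Real.GammaSeq_tendsto_Gamma x).inv₀ (Real.Gamma_pos_of_pos hx).ne'
    have h2 := h.const_mul (Real.Gamma x)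
    rw [mul_inv_cancel₀ (Real.Gamma_pos_of_pos hx).ne'] at h2
    refine h2.congr fun r => ?_
    have h3 := Gamma_add_nat_eq_prod hx (r + 1)
    rw [Nat.cast_zero, sub_zero, show (r : ℝ) + 1 + x = x + (r + 1 : ℕ) by push_cast; ring, h3,
      Real.GammaSeq, Real.rpow_neg (by positivity)]
    field_simp
  | succ m ih =>
    rw [powTail_iff] at ih ⊢
    have hlim := tendsto_add_mul_div_add_mul_atTop_nhds (0 : ℝ) (1 + (x - (m + 1))) 1
      (d := (1 : ℝ)) one_ne_zero
    have := ih.mul hlim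
    rw [div_one, mul_one] at this
    refine this.congr' ?_
    filter_upwards [eventually_gt_atTop (m + 1)] with r hr
    have hr' : (m : ℝ) + 1 < r := by exact_mod_cast hr
    have hr0 : (0 : ℝ) < r := by
      have : (0 : ℝ) ≤ m := by positivity
      linarith
    have hpos : (0 : ℝ) < r + 1 + (x - (m + 1)) := by linarith
    have e : (r : ℝ) + 1 + (x - m) = (r + 1 + (x - (m + 1))) + 1 := by ring
    have e2 : -(x - ((m + 1 : ℕ) : ℝ)) = -(x - m) + 1 := by push_cast; ring
    rw [e, Real.Gamma_add_one hpos.ne', e2, Real.rpow_add_one hr0.ne']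
    push_cast
    have h3 : (1 + (x - (m + 1)) + 1 * (r : ℝ)) ≠ 0 := by
      rw [one_mul]; intro h; linarith
    rw [show (r : ℝ) + 1 + (x - (m + 1)) = 1 + (x - (m + 1)) + 1 * r by ring]
    generalize 1 + (x - ((m : ℝ) + 1)) + 1 * r = y at h3 ⊢
    field_simp
    ring

lemma powTail_Gamma (κ : ℝ) :
    PowTail (fun r => Real.Gamma (r + 1 - κ) / (r.factorial : ℝ)) κ 1 := by
  obtain ⟨m, hm⟩ := exists_nat_gt κ
  have h := powTail_Gamma_sub (x := m - κ) (by linarith) m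
  simp only [show (m : ℝ) - κ - m = -κ by ring, neg_neg] at h
  simpa only [sub_eq_add_neg] using h

/-! ### Mixed Poisson probabilities of a power mixing density -/

/-- The comparison of a Poisson mixture by `f` with the mixture by the exact power `X ^ (-κ)`, for
an arbitrary reference measure `ν`: mixing values below a fixed level contribute only
`O(z ^ r / r!)`. -/
lemma powTail_mixture {α : Type*} [MeasurableSpace α] {ν : Measure α} {X : α → ℝ}
    (hX : ∀ᵐ a ∂ν, 0 ≤ X a) {f : α → ℝ} {s κ c M : ℝ} (hs : 0 < s) (m : ℕ)
    (hf : ∀ ε > 0, ∃ T : ℝ, 0 < T ∧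
      ∀ᵐ a ∂ν, T ≤ X a → |f a - c * X a ^ (-κ)| ≤ ε * X a ^ (-κ))
    (hfi : ∀ r ≥ m, Integrable (fun a => poissonProb (s * X a) r * f a) ν)
    (hXi : ∀ r ≥ m, Integrable (fun a => poissonProb (s * X a) r * X a ^ (-κ)) ν)
    (hM : PowTail (fun r => ∫ a, poissonProb (s * X a) r * X a ^ (-κ) ∂ν) κ M) :
    PowTail (fun r => ∫ a, poissonProb (s * X a) r * f a ∂ν) κ (c * M) := by
  set I : ℕ → ℝ := fun r => ∫ a, poissonProb (s * X a) r * X a ^ (-κ) ∂ν with hI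
  have hdiff : ∀ r ≥ m, Integrable
      (fun a => poissonProb (s * X a) r * (f a - c * X a ^ (-κ))) ν := fun r hr => by
    refine ((hfi r hr).sub ((hXi r hr).const_mul c)).congr (Eventually.of_forall fun a => ?_)
    simp only [Pi.sub_apply]; ring
  have key : PowTail (fun r => (∫ a, poissonProb (s * X a) r * f a ∂ν) - c * I r) κ 0 := by
    refine Metric.tendsto_nhds.mpr fun η hη => ?_
    -- With this `ε` the mixing values above `T` contribute at most `ε (|M| + 1) = η / 2`.
    set ε := η / (2 * (|M| + 1)) with hε
    have hεpos : 0 < ε := by positivity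
    obtain ⟨T, hT, hfT⟩ := hf ε hεpos
    set E := ∫ a, ‖poissonProb (s * X a) m * (f a - c * X a ^ (-κ))‖ ∂ν with hE
    set K : ℕ → ℝ := fun r => (s * T) ^ (r - m) * m.factorial / r.factorial with hK
    have hbound : ∀ r ≥ m, |(∫ a, poissonProb (s * X a) r * f a ∂ν) - c * I r| ≤
        ε * I r + K r * E := by
      intro r hr
      have h1 : (∫ a, poissonProb (s * X a) r * f a ∂ν) - c * I r =
          ∫ a, poissonProb (s * X a) r * (f a - c * X a ^ (-κ)) ∂ν := by
        rw [hI, ← integral_const_mul, ← integral_sub (hfi r hr) ((hXi r hr).const_mul c)]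
        congr 1 with a
        ring
      rw [h1, hI, hE, ← integral_const_mul, ← integral_const_mul,
        ← integral_add ((hXi r hr).const_mul ε) ((hdiff m le_rfl).norm.const_mul _)]
      refine (abs_integral_le_integral_abs).trans (integral_mono_ae (hdiff r hr).abs
        (((hXi r hr).const_mul ε).add ((hdiff m le_rfl).norm.const_mul _)) ?_)
      filter_upwards [hX, hfT] with a ha hfa
      have hp : ∀ r, 0 ≤ poissonProb (s * X a) r := poissonProb_nonneg (by positivity)
      rw [abs_mul, abs_of_nonneg (hp r), norm_mul, Real.norm_eq_abs, Real.norm_eq_abs,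
        abs_of_nonneg (hp m)]
      have hXp : 0 ≤ X a ^ (-κ) := Real.rpow_nonneg ha _
      rcases le_or_gt T (X a) with hTa | hTa
      · have := hfa hTa
        have h2 : 0 ≤ K r * (poissonProb (s * X a) m * |f a - c * X a ^ (-κ)|) := by
          have := hp m
          positivity
        nlinarith [mul_le_mul_of_nonneg_left this (hp r)]
      · -- Below `T` the Poisson probability at `r` is compared with the one at the fixed `m`,
        -- which is integrable against both `f` and `X ^ (-κ)`.
        have h3 : poissonProb (s * X a) r ≤ K r * poissonProb (s * X a) m := by
          have e : poissonProb (s * X a) r = (s * X a) ^ (r - m) * m.factorial / r.factorial *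
              poissonProb (s * X a) m := by
            unfold poissonProb
            rw [← Nat.sub_add_cancel hr, pow_add, Nat.add_sub_cancel]
            field_simp
          rw [e]
          refine mul_le_mul_of_nonneg_right ?_ (hp m)
          simp only [hK]
          gcongr
        have h4 : 0 ≤ ε * (poissonProb (s * X a) r * X a ^ (-κ)) := by
          have := hp r
          positivity
        nlinarith [mul_le_mul_of_nonneg_right h3 (abs_nonneg (f a - c * X a ^ (-κ)))]
    have hKlim : PowTail (fun r => K r * E) κ 0 := by
      have h5 := (powTail_pow_div_factorial (s * T) κ).const_mul
        ((s * T) ^ (-(m : ℤ)) * m.factorial * E)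
      rw [mul_zero] at h5
      refine Tendsto.congr' ?_ h5
      filter_upwards [eventually_ge_atTop m] with r hr
      have : (s * T) ^ r = (s * T) ^ (r - m) * (s * T) ^ m := by
        rw [← pow_add, Nat.sub_add_cancel hr]
      simp only [hK, this, zpow_neg, zpow_natCast]
      field_simp
    have hMlim : ∀ᶠ r in atTop, |I r * ((r : ℝ) + 1) ^ κ| < |M| + 1 :=
      (Tendsto.abs hM).eventually_lt_const (by linarith)
    have hKsmall : ∀ᶠ r in atTop, |K r * E * ((r : ℝ) + 1) ^ κ| < η / 2 := by
      have := Tendsto.abs hKlim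
      rw [abs_zero] at this
      exact this.eventually_lt_const (by linarith)
    filter_upwards [hMlim, hKsmall, eventually_ge_atTop m] with r h6 h7 h8
    rw [dist_zero_right, norm_mul, Real.norm_eq_abs, Real.norm_eq_abs]
    have hpos : (0 : ℝ) < ((r : ℝ) + 1) ^ κ := by positivity
    rw [abs_of_pos hpos]
    calc _ ≤ (ε * I r + K r * E) * ((r : ℝ) + 1) ^ κ :=
          mul_le_mul_of_nonneg_right (hbound r h8) hpos.le
      _ = ε * (I r * ((r : ℝ) + 1) ^ κ) + K r * E * ((r : ℝ) + 1) ^ κ := by ring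
      _ ≤ ε * |I r * ((r : ℝ) + 1) ^ κ| + |K r * E * ((r : ℝ) + 1) ^ κ| := by
          gcongr <;> exact le_abs_self _
      _ < ε * (|M| + 1) + η / 2 := by
          have := mul_lt_mul_of_pos_left h6 hεpos
          linarith
      _ = η := by rw [hε]; field_simp; ring
  have := Tendsto.add key (Tendsto.const_mul c hM)
  rw [zero_add] at this
  refine this.congr fun r => ?_
  ring

lemma poissonProb_mul_rpow {s t κ : ℝ} {r : ℕ} (ht : 0 ≤ t) (hr : κ < r) (hr0 : r ≠ 0) :
    poissonProb (s * t) r * t ^ (-κ) =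
      s ^ r / r.factorial * (t ^ ((r : ℝ) - κ) * Real.exp (-(s * t))) := by
  unfold poissonProb
  rcases ht.eq_or_lt with rfl | ht
  · have h : (r : ℝ) - κ ≠ 0 := by linarith
    simp [hr0, Real.zero_rpow h]
  · rw [sub_eq_add_neg, Real.rpow_add ht, Real.rpow_natCast, mul_pow]
    ring

lemma integrableOn_rpow_mul_exp {s α : ℝ} (hs : 0 < s) (hα : -1 < α) :
    IntegrableOn (fun t : ℝ => t ^ α * Real.exp (-(s * t))) (Set.Ioi 0) := by
  have := integrableOn_rpow_mul_exp_neg_mul_rpow hα one_pos hs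
  refine this.congr_fun (fun t _ => ?_) measurableSet_Ioi
  simp [Real.rpow_one]

lemma integral_rpow_mul_exp {s α : ℝ} (hs : 0 < s) (hα : -1 < α) :
    ∫ t in Set.Ioi (0 : ℝ), t ^ α * Real.exp (-(s * t)) =
      (1 / s) ^ (α + 1) * Real.Gamma (α + 1) := by
  have := Real.integral_rpow_mul_exp_neg_mul_Ioi (a := α + 1) (by linarith) hs
  rwa [add_sub_cancel_right] at this

lemma const_mul_integral_rpow_mul_exp {s κ : ℝ} {r : ℕ} (hs : 0 < s) (hr : κ < r) :
    s ^ r / r.factorial * ∫ t in Set.Ioi (0 : ℝ), t ^ ((r : ℝ) - κ) * Real.exp (-(s * t)) =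
      s ^ (κ - 1) * (Real.Gamma (r + 1 - κ) / r.factorial) := by
  rw [integral_rpow_mul_exp hs (by linarith), one_div, Real.inv_rpow hs.le,
    ← Real.rpow_neg hs.le, ← Real.rpow_natCast s r,
    show (r : ℝ) - κ + 1 = r + 1 - κ by ring,
    show κ - 1 = r + -((r : ℝ) + 1 - κ) by ring, Real.rpow_add hs]
  ring

/-- The Lebesgue case: the mixture of Poisson laws by `t ^ (-κ) dt` is an explicit Gamma
integral. -/
lemma powTail_lebesgue_mixture {s : ℝ} (hs : 0 < s) (κ : ℝ) :
    PowTail (fun r => ∫ t in Set.Ioi (0 : ℝ), poissonProb (s * t) r * t ^ (-κ)) κ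
      (s ^ (κ - 1)) := by
  have h := (powTail_Gamma κ).const_mul (s ^ (κ - 1))
  rw [mul_one] at h
  obtain ⟨m, hm⟩ := exists_nat_gt κ
  refine Tendsto.congr' ?_ h
  filter_upwards [eventually_ge_atTop (m + 1)] with r hr
  have hr' : (m : ℝ) + 1 ≤ r := by exact_mod_cast hr
  rw [← const_mul_integral_rpow_mul_exp hs (by linarith), ← integral_const_mul]
  congr 1
  refine setIntegral_congr_fun measurableSet_Ioi fun t ht => ?_
  exact (poissonProb_mul_rpow (le_of_lt ht) (by linarith) (by omega)).symm

/-- The sum of a non-negative function over `ℕ` differs from its integral by at most the integral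
of a bound on its derivative. -/
lemma abs_tsum_sub_integral_le {g g' B : ℝ → ℝ} (hg : ∀ t, HasDerivAt g (g' t) t)
    (hg' : Continuous g') (hpos : ∀ n : ℕ, 0 ≤ g n) (hgi : IntegrableOn g (Set.Ioi 0))
    (hBi : IntegrableOn B (Set.Ioi 0)) (hB : ∀ t, 0 < t → |g' t| ≤ B t) :
    Summable (fun n : ℕ => g n) ∧
      |∑' n : ℕ, g n - ∫ t in Set.Ioi (0 : ℝ), g t| ≤ ∫ t in Set.Ioi (0 : ℝ), B t := by
  have hgc : Continuous g := continuous_iff_continuousAt.mpr fun t => (hg t).continuousAt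
  have hBI : ∀ a b : ℝ, 0 ≤ a → a ≤ b → IntervalIntegrable B volume a b := fun a b ha hab => by
    rw [intervalIntegrable_iff_integrableOn_Ioc_of_le hab]
    exact hBi.mono_set fun t ht => lt_of_le_of_lt ha ht.1
  -- Integration by parts on `[n, n + 1]` against the weight `n + 1 - t ∈ [0, 1]`.
  have hstep : ∀ n : ℕ, |(∫ t in (n : ℝ)..((n + 1 : ℕ) : ℝ), g t) - g n| ≤
      ∫ t in (n : ℝ)..((n + 1 : ℕ) : ℝ), B t := by
    intro n
    have hn : (n : ℝ) ≤ ((n + 1 : ℕ) : ℝ) := by push_cast; linarith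
    have hu : ∀ t ∈ Set.uIcc (n : ℝ) ((n + 1 : ℕ) : ℝ),
        HasDerivAt (fun t : ℝ => ((n : ℝ) + 1) - t) (-1) t := fun t _ =>
      (hasDerivAt_id t).const_sub _
    have hp := intervalIntegral.integral_mul_deriv_eq_deriv_mul hu (fun t _ => hg t)
      (continuous_const.intervalIntegrable _ _) (hg'.intervalIntegrable _ _)
    have hp2 : (∫ t in (n : ℝ)..((n + 1 : ℕ) : ℝ), g t) - g n =
        ∫ t in (n : ℝ)..((n + 1 : ℕ) : ℝ), ((n : ℝ) + 1 - t) * g' t := by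
      rw [hp]
      push_cast
      simp only [neg_mul, one_mul, intervalIntegral.integral_neg]
      ring
    rw [hp2]
    have := intervalIntegral.norm_integral_le_of_norm_le hn (μ := volume)
      (f := fun t => ((n : ℝ) + 1 - t) * g' t) (g := B) ?_ (hBI _ _ (by positivity) hn)
    · simpa using this
    · refine Eventually.of_forall fun t ht => ?_
      push_cast at ht
      have hn0 : (0 : ℝ) ≤ n := by positivity
      rw [norm_mul, Real.norm_eq_abs, Real.norm_eq_abs, abs_of_nonneg (by linarith [ht.2])]
      have h1 := hB t (by linarith [ht.1])
      have h2 : (n : ℝ) + 1 - t ≤ 1 := by linarith [ht.1]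
      calc _ ≤ 1 * |g' t| := mul_le_mul_of_nonneg_right h2 (abs_nonneg _)
        _ ≤ B t := by rwa [one_mul]
  have hBpos : ∀ t ∈ Set.Ioi (0 : ℝ), 0 ≤ B t := fun t ht => (abs_nonneg _).trans (hB t ht)
  have hpart : ∀ N : ℕ, |∑ n ∈ Finset.range N, g n - ∫ t in (0 : ℝ)..N, g t| ≤
      ∫ t in Set.Ioi (0 : ℝ), B t := by
    intro N
    have e1 := intervalIntegral.sum_integral_adjacent_intervals (f := g) (μ := volume)
      (a := fun n : ℕ => (n : ℝ)) (n := N) fun k _ => hgc.intervalIntegrable _ _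
    have e2 := intervalIntegral.sum_integral_adjacent_intervals (f := B) (μ := volume)
      (a := fun n : ℕ => (n : ℝ)) (n := N) fun k _ =>
        hBI _ _ (by positivity) (by push_cast; linarith)
    simp only [Nat.cast_zero] at e1 e2
    rw [← e1, ← Finset.sum_sub_distrib]
    refine (Finset.abs_sum_le_sum_abs _ _).trans ?_
    calc _ ≤ ∑ n ∈ Finset.range N, ∫ t in (n : ℝ)..((n + 1 : ℕ) : ℝ), B t :=
          Finset.sum_le_sum fun n _ => by rw [abs_sub_comm]; exact hstep n
      _ = ∫ t in (0 : ℝ)..N, B t := e2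
      _ ≤ _ := by
          rw [intervalIntegral.integral_of_le (by positivity)]
          exact setIntegral_mono_set hBi
            ((ae_restrict_iff' measurableSet_Ioi).mpr (Eventually.of_forall hBpos))
            (Eventually.of_forall fun t ht => ht.1)
  have hlim := intervalIntegral_tendsto_integral_Ioi (0 : ℝ) hgi
    (tendsto_natCast_atTop_atTop (R := ℝ))
  have hsum : Summable (fun n : ℕ => g n) := by
    obtain ⟨C, hC⟩ := (Metric.isBounded_range_of_tendsto _ hlim).exists_norm_le
    refine summable_of_sum_range_le (c := C + ∫ t in Set.Ioi (0 : ℝ), B t) hpos fun N => ?_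
    have h1 := (abs_le.mp (hpart N)).2
    have h2 := (le_abs_self _).trans (hC _ ⟨N, rfl⟩)
    linarith
  exact ⟨hsum, le_of_tendsto (hsum.hasSum.tendsto_sum_nat.sub hlim).abs
    (Eventually.of_forall hpart)⟩

/-- The sum over `ℕ` of `t ^ α e ^ (-s t)` against its integral. With `ε = s / √(α - 1)` the bound
`|α / t - s| ≤ ε / 2 + (α / t - s) ^ 2 / (2 ε)` on the logarithmic derivative integrates to
exactly `ε` times the integral. -/
lemma abs_tsum_rpow_mul_exp_sub_le {s α : ℝ} (hs : 0 < s) (hα : 2 < α) :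
    Summable (fun n : ℕ => (n : ℝ) ^ α * Real.exp (-(s * n))) ∧
      |∑' n : ℕ, (n : ℝ) ^ α * Real.exp (-(s * n)) -
        ∫ t in Set.Ioi (0 : ℝ), t ^ α * Real.exp (-(s * t))| ≤
      s / √(α - 1) * ∫ t in Set.Ioi (0 : ℝ), t ^ α * Real.exp (-(s * t)) := by
  set ε := s / √(α - 1) with hε
  have hroot : 0 < √(α - 1) := Real.sqrt_pos.mpr (by linarith)
  have hεpos : 0 < ε := by positivity
  have hε2 : s ^ 2 = ε ^ 2 * (α - 1) := by
    rw [hε, div_pow, Real.sq_sqrt (by linarith)]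
    have : α - 1 ≠ 0 := by linarith
    field_simp
  have hi := fun (b : ℝ) (hb : -1 < b) => integrableOn_rpow_mul_exp hs hb
  set B : ℝ → ℝ := fun t => (ε / 2 + s ^ 2 / (2 * ε)) * (t ^ α * Real.exp (-(s * t))) -
    α * s / ε * (t ^ (α - 1) * Real.exp (-(s * t))) +
    α ^ 2 / (2 * ε) * (t ^ (α - 2) * Real.exp (-(s * t))) with hBdef
  have hi0 := (hi α (by linarith)).const_mul (ε / 2 + s ^ 2 / (2 * ε))
  have hi1 := (hi (α - 1) (by linarith)).const_mul (α * s / ε)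
  have hi2 := (hi (α - 2) (by linarith)).const_mul (α ^ 2 / (2 * ε))
  have hBi : IntegrableOn B (Set.Ioi 0) := (hi0.sub hi1).add hi2
  have hBint : ∫ t in Set.Ioi (0 : ℝ), B t =
      ε * ∫ t in Set.Ioi (0 : ℝ), t ^ α * Real.exp (-(s * t)) := by
    have hsplit : ∫ t in Set.Ioi (0 : ℝ), B t = _ :=
      (integral_add (hi0.sub hi1) hi2).trans (congrArg (· + _) (integral_sub hi0 hi1))
    rw [hsplit, integral_const_mul, integral_const_mul, integral_const_mul,
      integral_rpow_mul_exp hs (by linarith),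
      integral_rpow_mul_exp hs (by linarith), integral_rpow_mul_exp hs (by linarith)]
    have hs' : (0 : ℝ) < 1 / s := by positivity
    have hG1 : Real.Gamma α = (α - 1) * Real.Gamma (α - 1) := by
      rw [← Real.Gamma_add_one (by linarith), sub_add_cancel]
    have hp1 : (1 / s) ^ α = (1 / s) ^ (α - 1) * (1 / s) := by
      rw [← Real.rpow_add_one hs'.ne', sub_add_cancel]
    rw [Real.Gamma_add_one (s := α) (by linarith), Real.rpow_add_one hs'.ne' α, sub_add_cancel,
      show α - 2 + 1 = α - 1 by ring, hG1, hp1]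
    have h1 : α - 1 ≠ 0 := by linarith
    field_simp
    rw [hε2]
    ring
  rw [← hBint]
  refine abs_tsum_sub_integral_le (g := fun t => t ^ α * Real.exp (-(s * t)))
    (g' := fun t => α * t ^ (α - 1) * Real.exp (-(s * t)) +
      t ^ α * (Real.exp (-(s * t)) * (-(s * 1)))) (fun t => ?_) ?_ (fun n => by positivity)
    (hi α (by linarith)) hBi fun t ht => ?_
  · exact (Real.hasDerivAt_rpow_const (Or.inr (by linarith))).mul
      (((hasDerivAt_id t).const_mul s).neg.exp)
  · have h1 : Continuous fun t : ℝ => t ^ (α - 1) :=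
      continuous_id.rpow_const fun _ => Or.inr (by linarith)
    have h2 : Continuous fun t : ℝ => t ^ α :=
      continuous_id.rpow_const fun _ => Or.inr (by linarith)
    fun_prop
  · set e := Real.exp (-(s * t))
    have he : 0 < e := Real.exp_pos _
    have h2 : t ^ α = t ^ (α - 2) * t ^ 2 := by
      rw [← Real.rpow_natCast t 2, ← Real.rpow_add ht]; congr 1; push_cast; ring
    have h1 : t ^ (α - 1) = t ^ (α - 2) * t := by
      rw [← Real.rpow_add_one ht.ne']; congr 1; ring
    have hp : 0 < t ^ (α - 2) := Real.rpow_pos_of_pos ht _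
    simp only [hBdef, h1, h2]
    have e1 : α * (t ^ (α - 2) * t) * e + t ^ (α - 2) * t ^ 2 * (e * (-(s * 1))) =
        t ^ (α - 2) * e * (t * (α - s * t)) := by ring
    have e2 : (ε / 2 + s ^ 2 / (2 * ε)) * (t ^ (α - 2) * t ^ 2 * e) -
        α * s / ε * (t ^ (α - 2) * t * e) + α ^ 2 / (2 * ε) * (t ^ (α - 2) * e) =
        t ^ (α - 2) * e * ((ε ^ 2 * t ^ 2 + (α - s * t) ^ 2) / (2 * ε)) := by
      field_simp
      ring
    rw [e1, e2, abs_mul, abs_of_pos (by positivity : 0 < t ^ (α - 2) * e)]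
    refine mul_le_mul_of_nonneg_left ?_ (by positivity)
    rw [le_div_iff₀ (by positivity), abs_mul, abs_of_pos ht, ← sq_abs (α - s * t)]
    nlinarith [sq_nonneg (ε * t - |α - s * t|)]

/-- The counting case: the sum over the integers has the same asymptotics as the integral. At
`n = 0` the junk value `0 ^ (-κ)` is harmless, since the Poisson factor vanishes for `r ≠ 0`. -/
lemma powTail_counting_mixture {s : ℝ} (hs : 0 < s) (κ : ℝ) :
    PowTail (fun r => ∑' n : ℕ, poissonProb (s * n) r * (n : ℝ) ^ (-κ)) κ (s ^ (κ - 1)) := by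
  have h := (powTail_Gamma κ).const_mul (s ^ (κ - 1))
  rw [mul_one] at h
  have hbig : Tendsto (fun r : ℕ => (r : ℝ) - κ - 1) atTop atTop := by
    simpa only [sub_eq_add_neg] using tendsto_atTop_add_const_right _ (-1 : ℝ)
      (tendsto_atTop_add_const_right _ (-κ) (tendsto_natCast_atTop_atTop (R := ℝ)))
  have hε : Tendsto (fun r : ℕ => s / √((r : ℝ) - κ - 1)) atTop (𝓝 0) :=
    tendsto_const_nhds.div_atTop (Real.tendsto_sqrt_atTop.comp hbig)
  have hdiff : PowTail (fun r => (∑' n : ℕ, poissonProb (s * n) r * (n : ℝ) ^ (-κ)) -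
      s ^ (κ - 1) * (Real.Gamma (r + 1 - κ) / (r.factorial : ℝ))) κ 0 := by
    refine squeeze_zero_norm' ?_ (by simpa using hε.mul h)
    filter_upwards [hbig.eventually_gt_atTop 1, eventually_gt_atTop 0] with r hr hr0
    have hp : (0 : ℝ) < ((r : ℝ) + 1) ^ κ := by positivity
    rw [norm_mul, Real.norm_eq_abs, Real.norm_eq_abs, abs_of_pos hp, ← mul_assoc]
    refine mul_le_mul_of_nonneg_right ?_ hp.le
    have h1 := (abs_tsum_rpow_mul_exp_sub_le hs (α := (r : ℝ) - κ) (by linarith)).2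
    have e : ∀ n : ℕ, poissonProb (s * n) r * (n : ℝ) ^ (-κ) =
        s ^ r / r.factorial * ((n : ℝ) ^ ((r : ℝ) - κ) * Real.exp (-(s * n))) := fun n =>
      poissonProb_mul_rpow (by positivity) (by linarith) hr0.ne'
    simp only [e]
    rw [tsum_mul_left, ← const_mul_integral_rpow_mul_exp hs (by linarith), ← mul_sub, abs_mul,
      abs_of_pos (by positivity : 0 < s ^ r / (r.factorial : ℝ)), mul_left_comm]
    exact mul_le_mul_of_nonneg_left h1 (by positivity)
  have := Tendsto.add hdiff h
  rw [zero_add] at this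
  refine this.congr fun r => ?_
  ring

lemma summable_counting_mixture {s : ℝ} (hs : 0 < s) {κ : ℝ} {r : ℕ} (hr : κ + 2 < r)
    (hr0 : r ≠ 0) : Summable (fun n : ℕ => poissonProb (s * n) r * (n : ℝ) ^ (-κ)) := by
  have h1 := (abs_tsum_rpow_mul_exp_sub_le hs (α := (r : ℝ) - κ) (by linarith)).1.mul_left
    (s ^ r / (r.factorial : ℝ))
  refine h1.congr fun n => ?_
  exact (poissonProb_mul_rpow (by positivity) (by linarith) hr0).symm

/-! ### Mixed Poisson probabilities of a law with a power tail -/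

lemma integral_count_eq_tsum {g : ℕ → ℝ} (hg : Summable fun n => ‖g n‖) :
    ∫ n, g n ∂Measure.count = ∑' n, g n := by
  rw [integral_countable (integrable_count_iff.mpr hg)]
  simp [measureReal_def]

/-- A Poisson mixture over the integers inherits the power tail of its weights. -/
lemma powTail_nat_mixture {w : ℕ → ℝ} {κ c s : ℝ} (hs : 0 < s) (hw : PowTail w κ c)
    (hsum : Summable fun n => |w n|) :
    PowTail (fun r => ∑' n : ℕ, poissonProb (s * n) r * w n) κ (c * s ^ (κ - 1)) := by
  obtain ⟨m₀, hm₀⟩ := exists_nat_gt (κ + 2)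
  have hwi : ∀ r, Summable fun n : ℕ => ‖poissonProb (s * n) r * w n‖ := fun r => by
    refine Summable.of_nonneg_of_le (fun _ => norm_nonneg _) (fun n => ?_) hsum
    have h0 : 0 ≤ poissonProb (s * n) r := poissonProb_nonneg (by positivity) r
    rw [norm_mul, Real.norm_eq_abs, Real.norm_eq_abs, abs_of_nonneg h0]
    exact mul_le_of_le_one_left (abs_nonneg _) (poissonProb_le_one (by positivity) r)
  have hXi : ∀ r ≥ m₀ + 1, Summable fun n : ℕ => ‖poissonProb (s * n) r * (n : ℝ) ^ (-κ)‖ :=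
    fun r hr => by
      have : (m₀ : ℝ) + 1 ≤ r := by exact_mod_cast hr
      exact (summable_counting_mixture hs (by linarith) (by omega)).norm
  have := powTail_mixture (ν := (Measure.count : Measure ℕ)) (X := fun n : ℕ => (n : ℝ)) (f := w)
    (κ := κ) (c := c) (M := s ^ (κ - 1)) (Eventually.of_forall fun n => by positivity) hs (m₀ + 1)
    (fun ε hε => ?_) (fun r _ => integrable_count_iff.mpr (hwi r))
    (fun r hr => integrable_count_iff.mpr (hXi r hr)) ?_
  · refine Tendsto.congr (fun r => ?_) this
    beta_reduce
    rw [integral_count_eq_tsum (hwi r)]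
  · have h1 := (Metric.tendsto_atTop.mp (powTail_iff.mp hw)) ε hε
    obtain ⟨N, hN⟩ := h1
    refine ⟨N + 1, by positivity, Eventually.of_forall fun n hn => ?_⟩
    have hn0 : (0 : ℝ) < n := by
      have : (0 : ℝ) ≤ N := by positivity
      linarith
    have h2 := hN n (by
      have : (N : ℝ) ≤ n := by linarith
      exact_mod_cast this)
    rw [Real.dist_eq] at h2
    have hp : (0 : ℝ) < (n : ℝ) ^ (-κ) := by positivity
    have e : w n - c * (n : ℝ) ^ (-κ) = (w n * (n : ℝ) ^ κ - c) * (n : ℝ) ^ (-κ) := by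
      have : (n : ℝ) ^ κ ≠ 0 := by positivity
      rw [Real.rpow_neg hn0.le]
      field_simp
    rw [e, abs_mul, abs_of_pos hp]
    exact mul_le_mul_of_nonneg_right h2.le hp.le
  · refine Tendsto.congr' ?_ (powTail_counting_mixture hs κ)
    filter_upwards [eventually_ge_atTop (m₀ + 1)] with r hr
    rw [integral_count_eq_tsum (hXi r hr)]

/-- The push-forward along the floor function turns a law carried by the integers into a law on
`ℕ`. -/
lemma integral_eq_tsum_of_ae_nat {P : Measure ℝ} [IsProbabilityMeasure P]
    (hP : ∀ᵐ z ∂P, ∃ r : ℕ, z = (r : ℝ)) {g : ℝ → ℝ} (hg : Continuous g)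
    (hgi : Integrable g P) :
    ∫ z, g z ∂P = ∑' n : ℕ, g n * P.real ({(n : ℝ)} : Set ℝ) := by
  have hm : Measurable (fun z : ℝ => ⌊z⌋₊) := Nat.measurable_floor
  have hae : (fun z : ℝ => g (⌊z⌋₊ : ℝ)) =ᵐ[P] g := by
    filter_upwards [hP] with z ⟨r, hr⟩
    rw [hr, Nat.floor_natCast]
  have hi : Integrable (fun n : ℕ => g (n : ℝ)) (P.map fun z => ⌊z⌋₊) := by
    rw [integrable_map_measure (by fun_prop) hm.aemeasurable]
    exact hgi.congr hae.symm
  rw [← integral_congr_ae hae, ← integral_map (φ := fun z : ℝ => ⌊z⌋₊)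
    (f := fun n : ℕ => g (n : ℝ)) hm.aemeasurable (by fun_prop), integral_countable hi]
  refine tsum_congr fun n => ?_
  rw [smul_eq_mul, mul_comm]
  congr 1
  rw [measureReal_def, measureReal_def, Measure.map_apply hm (measurableSet_singleton n)]
  congr 1
  refine measure_congr ?_
  filter_upwards [hP] with z ⟨r, hr⟩
  refine propext ?_
  change ⌊z⌋₊ = n ↔ z = n
  rw [hr, Nat.floor_natCast, Nat.cast_inj]

lemma integrable_poissonProb {P : Measure ℝ} [IsProbabilityMeasure P] (hP : ∀ᵐ z ∂P, 0 ≤ z)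
    {s : ℝ} (hs : 0 ≤ s) (r : ℕ) : Integrable (fun z => poissonProb (s * z) r) P := by
  refine Integrable.of_bound (C := 1)
    ((continuous_poissonProb r).comp (continuous_const_mul s)).aestronglyMeasurable ?_
  filter_upwards [hP] with z hz
  rw [Real.norm_eq_abs, abs_of_nonneg (poissonProb_nonneg (by positivity) r)]
  exact poissonProb_le_one (by positivity) r

/-- A mixed Poisson variable inherits the power tail of its mixing law, whether this law is
discrete or has a density. -/
lemma PropertyA.powTail_mixedPoisson {P : Measure ℝ} [IsProbabilityMeasure P] {c κ s : ℝ}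
    (hA : PropertyA P c κ) (hP : ∀ᵐ z ∂P, 0 ≤ z) (hc : 0 < c) (hs : 0 < s) :
    PowTail (mixedPoisson P s) κ (c * s ^ (κ - 1)) := by
  rcases hA with ⟨hint, htail⟩ | ⟨f, hfm, hf0, hPf, hftail⟩
  · have hw : PowTail (fun r : ℕ => P.real ({(r : ℝ)} : Set ℝ)) κ c := by
      rw [powTail_iff]
      have hv : ∀ᶠ r : ℕ in atTop, c * (r : ℝ) ^ (-κ) ≠ 0 := by
        filter_upwards [eventually_gt_atTop 0] with r hr
        have hr' : (0 : ℝ) < r := by exact_mod_cast hr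
        positivity
      have h1 := ((isEquivalent_iff_tendsto_one hv).mp htail).const_mul c
      rw [mul_one] at h1
      refine h1.congr' ?_
      filter_upwards [eventually_gt_atTop 0] with r hr
      have hr' : (0 : ℝ) < r := by exact_mod_cast hr
      have : (r : ℝ) ^ κ ≠ 0 := by positivity
      simp only [Pi.div_apply]
      rw [Real.rpow_neg hr'.le]
      field_simp
    have hsum : Summable fun n : ℕ => |P.real ({(n : ℝ)} : Set ℝ)| := by
      have h2 : Summable fun n : ℕ => P.real ({(n : ℝ)} : Set ℝ) := by
        refine summable_of_sum_range_le (c := 1) (fun _ => measureReal_nonneg) fun n => ?_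
        rw [← measureReal_biUnion_finset (fun i _ j _ hij => by
          simpa [Function.onFun] using hij) fun _ _ => measurableSet_singleton _]
        exact measureReal_le_one
      exact h2.abs
    refine Tendsto.congr (fun r => ?_) (powTail_nat_mixture hs hw hsum)
    rw [mixedPoisson, integral_eq_tsum_of_ae_nat (g := fun z => poissonProb (s * z) r) hint
      ((continuous_poissonProb r).comp (continuous_const_mul s)) (integrable_poissonProb hP hs.le r)]
  · -- The reference measure has to live on the positive half-line, where the powers make sense.
    set ν : Measure ℝ := volume.restrict (Set.Ioi 0) with hν
    have hfm' : Measurable fun t => ENNReal.ofReal (f t) := hfm.ennreal_ofReal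
    have hPν : P = ν.withDensity fun t => ENNReal.ofReal (f t) := by
      have hpos : ∀ᵐ z ∂P, z ∈ Set.Ioi (0 : ℝ) := by
        have hac : P ≪ volume := by rw [hPf]; exact withDensity_absolutelyContinuous _ _
        have h0 : ∀ᵐ z ∂P, z ≠ 0 := hac.ae_le (Measure.ae_ne volume 0)
        filter_upwards [hP, h0] with z hz hz0
        exact lt_of_le_of_ne hz (Ne.symm hz0)
      rw [hν, ← restrict_withDensity measurableSet_Ioi, ← hPf,
        Measure.restrict_eq_self_of_ae_mem hpos]
    have hint : ∀ r, ∫ z, poissonProb (s * z) r ∂P = ∫ t, poissonProb (s * t) r * f t ∂ν := by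
      intro r
      conv_lhs => rw [hPν]
      rw [integral_withDensity_eq_integral_toReal_smul hfm'
        (Eventually.of_forall fun _ => ENNReal.ofReal_lt_top)]
      congr 1 with t
      rw [ENNReal.toReal_ofReal (hf0 t), smul_eq_mul, mul_comm]
    have hfi : ∀ r, Integrable (fun t => poissonProb (s * t) r * f t) ν := by
      intro r
      have h1 := integrable_poissonProb hP hs.le r
      rw [hPν, integrable_withDensity_iff_integrable_smul' hfm'
        (Eventually.of_forall fun _ => ENNReal.ofReal_lt_top)] at h1
      refine h1.congr (Eventually.of_forall fun t => ?_)
      simp only [ENNReal.toReal_ofReal (hf0 t), smul_eq_mul, mul_comm]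
    obtain ⟨m₀, hm₀⟩ := exists_nat_gt κ
    have := powTail_mixture (ν := ν) (X := id) (f := f) (κ := κ) (c := c) (M := s ^ (κ - 1))
      ((ae_restrict_iff' measurableSet_Ioi).mpr (Eventually.of_forall fun t ht => le_of_lt ht)) hs
      (m₀ + 1) (fun ε hε => ?_) (fun r _ => hfi r) (fun r hr => ?_)
      (powTail_lebesgue_mixture hs κ)
    · exact Tendsto.congr (fun r => by rw [mixedPoisson, hint r]; rfl) this
    · have h2 := hftail.isLittleO.def (c := ε / c) (by positivity)
      obtain ⟨T, hT⟩ := eventually_atTop.mp h2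
      refine ⟨max T 1, by positivity, Eventually.of_forall fun t ht => ?_⟩
      have ht0 : 0 < t := lt_of_lt_of_le one_pos ((le_max_right T 1).trans ht)
      have h3 := hT t ((le_max_left T 1).trans ht)
      simp only [Pi.sub_apply, Real.norm_eq_abs] at h3
      have hp : 0 < t ^ (-κ) := Real.rpow_pos_of_pos ht0 _
      rw [abs_of_pos (by positivity : 0 < c * t ^ (-κ))] at h3
      refine h3.trans (le_of_eq ?_)
      simp only [id]
      field_simp
    · have hr' : (m₀ : ℝ) + 1 ≤ r := by exact_mod_cast hr
      have h4 := (integrableOn_rpow_mul_exp hs (α := (r : ℝ) - κ) (by linarith)).const_mul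
        (s ^ r / (r.factorial : ℝ))
      refine IntegrableOn.congr_fun h4 (fun t ht => ?_) measurableSet_Ioi
      exact (poissonProb_mul_rpow (le_of_lt ht) (by linarith) (by omega)).symm

/-! ### Moments and size-biased mixtures -/

lemma hasSum_integral_of_nonneg {P : Measure ℝ} {F : ℕ → ℝ → ℝ} {G : ℝ → ℝ}
    (hF : ∀ n, Continuous (F n)) (h0 : ∀ᵐ z ∂P, ∀ n, 0 ≤ F n z)
    (hs : ∀ᵐ z ∂P, HasSum (fun n => F n z) (G z)) (hG : Integrable G P) :
    HasSum (fun n => ∫ z, F n z ∂P) (∫ z, G z ∂P) := by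
  refine hasSum_integral_of_dominated_convergence F (fun n => (hF n).aestronglyMeasurable)
    (fun n => ?_) ?_ ?_ hs
  · filter_upwards [h0] with z hz
    rw [Real.norm_eq_abs, abs_of_nonneg (hz n)]
  · filter_upwards [hs] with z hz using hz.summable
  · refine hG.congr ?_
    filter_upwards [hs] with z hz using hz.tsum_eq.symm

/-- The expectation `E (Z 1{Λ = r})`, where `Λ` given `Z` is Poisson with mean `s Z`. -/
def sizeBiasedPoisson (P : Measure ℝ) (s : ℝ) (r : ℕ) : ℝ := ∫ z, z * poissonProb (s * z) r ∂P

/-- The size-biased weights are again mixed Poisson probabilities, up to a factor `(r + 1) / s`;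
this is how they inherit a power tail. -/
lemma mul_sizeBiasedPoisson (P : Measure ℝ) (s : ℝ) (r : ℕ) :
    s * sizeBiasedPoisson P s r = ((r : ℝ) + 1) * mixedPoisson P s (r + 1) := by
  rw [sizeBiasedPoisson, mixedPoisson, ← integral_const_mul, ← integral_const_mul]
  congr 1 with z
  rw [succ_mul_poissonProb]
  ring

lemma sizeBiasedPoisson_nonneg {P : Measure ℝ} (hP : ∀ᵐ z ∂P, 0 ≤ z) {s : ℝ} (hs : 0 ≤ s)
    (r : ℕ) : 0 ≤ sizeBiasedPoisson P s r := by
  refine integral_nonneg_of_ae ?_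
  filter_upwards [hP] with z hz
  exact mul_nonneg hz (poissonProb_nonneg (by positivity) r)

lemma continuous_mul_poissonProb (s : ℝ) (r : ℕ) :
    Continuous fun z : ℝ => z * poissonProb (s * z) r :=
  continuous_id.mul ((continuous_poissonProb r).comp (continuous_const_mul s))

lemma hasSum_sizeBiasedPoisson {P : Measure ℝ} (hP : ∀ᵐ z ∂P, 0 ≤ z)
    (hi : Integrable (fun z => z) P) {s : ℝ} (hs : 0 ≤ s) :
    HasSum (sizeBiasedPoisson P s) (moment P 1) := by
  have := hasSum_integral_of_nonneg (P := P) (F := fun r z => z * poissonProb (s * z) r)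
    (G := fun z => z) (continuous_mul_poissonProb s)
    (by
      filter_upwards [hP] with z hz n
      exact mul_nonneg hz (poissonProb_nonneg (by positivity) n))
    (Eventually.of_forall fun z => by simpa using (hasSum_poissonProb (s * z)).mul_left z) hi
  simp only [moment, pow_one]
  exact this

lemma hasSum_mul_mixedPoisson {P : Measure ℝ} (hP : ∀ᵐ z ∂P, 0 ≤ z)
    (hi : Integrable (fun z => z) P) {s : ℝ} (hs : 0 ≤ s) :
    HasSum (fun r : ℕ => (r : ℝ) * mixedPoisson P s r) (s * moment P 1) := by
  rw [← hasSum_nat_add_iff' 1]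
  simpa [mul_sizeBiasedPoisson] using (hasSum_sizeBiasedPoisson hP hi hs).mul_left s

lemma meanOf_mixedPoisson {P : Measure ℝ} (hP : ∀ᵐ z ∂P, 0 ≤ z)
    (hi : Integrable (fun z => z) P) {s : ℝ} (hs : 0 ≤ s) :
    meanOf (mixedPoisson P s) = s * moment P 1 :=
  (hasSum_mul_mixedPoisson hP hi hs).tsum_eq

lemma moment_pos {P : Measure ℝ} (hP : ∀ᵐ z ∂P, 0 ≤ z) {i : ℕ} (hi0 : i ≠ 0)
    (hi : Integrable (fun z => z ^ i) P) (h0 : ¬ ∀ᵐ z ∂P, z = 0) : 0 < moment P i := by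
  have hn : 0 ≤ᵐ[P] fun z => z ^ i := by filter_upwards [hP] with z hz using pow_nonneg hz i
  refine lt_of_le_of_ne (integral_nonneg_of_ae hn) fun h => h0 ?_
  have := (integral_eq_zero_iff_of_nonneg_ae hn hi).mp h.symm
  filter_upwards [this] with z hz
  exact (pow_eq_zero_iff hi0).mp hz

section PropertyA

variable {P : Measure ℝ} [IsProbabilityMeasure P] {c κ : ℝ}

lemma PropertyA.powTail_succ_mul_mixedPoisson (hA : PropertyA P c κ) (hP : ∀ᵐ z ∂P, 0 ≤ z)
    (hc : 0 < c) {s : ℝ} (hs : 0 < s) :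
    PowTail (fun r : ℕ => ((r : ℝ) + 1) * mixedPoisson P s (r + 1)) (κ - 1) (c * s ^ (κ - 1)) :=
  ((hA.powTail_mixedPoisson hP hc hs).shift 1).succ_mul

lemma PropertyA.powTail_sizeBiasedPoisson (hA : PropertyA P c κ) (hP : ∀ᵐ z ∂P, 0 ≤ z)
    (hc : 0 < c) {s : ℝ} (hs : 0 < s) :
    PowTail (sizeBiasedPoisson P s) (κ - 1) (c * s ^ (κ - 2)) := by
  have h := (hA.powTail_succ_mul_mixedPoisson hP hc hs).const_mul s⁻¹
  have e : s⁻¹ * (c * s ^ (κ - 1)) = c * s ^ (κ - 2) := by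
    rw [show κ - 2 = κ - 1 - 1 by ring, Real.rpow_sub_one hs.ne' (κ - 1)]
    field_simp
  rw [e] at h
  refine Tendsto.congr (fun r => ?_) h
  beta_reduce
  rw [← mul_sizeBiasedPoisson]
  field_simp

/-- The constant `c` is positive, so the law has mass arbitrarily far out. -/
lemma PropertyA.not_ae_eq_zero (hA : PropertyA P c κ) (hP : ∀ᵐ z ∂P, 0 ≤ z) (hc : 0 < c) :
    ¬ ∀ᵐ z ∂P, z = 0 := by
  intro h0
  have h1 := hA.powTail_mixedPoisson hP hc one_pos
  rw [Real.one_rpow, mul_one] at h1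
  have h2 : Tendsto (fun r : ℕ => mixedPoisson P 1 r * ((r : ℝ) + 1) ^ κ) atTop (𝓝 0) := by
    refine Tendsto.congr' ?_ tendsto_const_nhds
    filter_upwards [eventually_gt_atTop 0] with r hr
    have : mixedPoisson P 1 r = 0 := by
      refine integral_eq_zero_of_ae ?_
      filter_upwards [h0] with z hz
      simp [hz, poissonProb, hr.ne']
    rw [this, zero_mul]
  exact hc.ne' (tendsto_nhds_unique h1 h2)

/-- A law with property `A_{c,κ}`, `κ > 2`, has a finite mean: by Tonelli the mean is
`∑ r P(Λ = r)` for a mixed Poisson variable `Λ`, whose tail is summable. -/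
lemma PropertyA.integrable (hA : PropertyA P c κ) (hP : ∀ᵐ z ∂P, 0 ≤ z) (hc : 0 < c)
    (hκ : 2 < κ) : Integrable (fun z => z) P := by
  have hsum : Summable (sizeBiasedPoisson P 1) :=
    ((hA.powTail_sizeBiasedPoisson hP hc one_pos).summable_abs (by linarith)).of_abs
  have hF0 : ∀ r : ℕ, 0 ≤ᵐ[P] fun z => z * poissonProb (1 * z) r := fun r => by
    filter_upwards [hP] with z hz
    exact mul_nonneg hz (poissonProb_nonneg (by linarith) r)
  have hFi : ∀ r : ℕ, Integrable (fun z => z * poissonProb (1 * z) r) P := fun r => by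
    refine ((integrable_poissonProb hP zero_le_one (r + 1)).const_mul ((r : ℝ) + 1)).congr
      (Eventually.of_forall fun z => ?_)
    simp only [succ_mul_poissonProb, one_mul]
  refine ⟨continuous_id.aestronglyMeasurable, ?_⟩
  rw [hasFiniteIntegral_iff_ofReal hP]
  have e : ∫⁻ z, ENNReal.ofReal z ∂P = ∑' r, ENNReal.ofReal (sizeBiasedPoisson P 1 r) := by
    simp only [sizeBiasedPoisson]
    simp_rw [fun r => ofReal_integral_eq_lintegral_ofReal (hFi r) (hF0 r)]
    rw [← lintegral_tsum fun r =>
      (continuous_mul_poissonProb 1 r).measurable.ennreal_ofReal.aemeasurable]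
    refine lintegral_congr_ae ?_
    filter_upwards [hP] with z hz
    have h1 := (hasSum_poissonProb (1 * z)).mul_left z
    rw [← ENNReal.ofReal_tsum_of_nonneg
      (fun n => mul_nonneg hz (poissonProb_nonneg (by linarith) n)) h1.summable, h1.tsum_eq,
      mul_one]
  rw [e, ← ENNReal.ofReal_tsum_of_nonneg
    (fun r => sizeBiasedPoisson_nonneg hP zero_le_one r) hsum]
  exact ENNReal.ofReal_lt_top

lemma PropertyA.moment_one_pos (hA : PropertyA P c κ) (hP : ∀ᵐ z ∂P, 0 ≤ z) (hc : 0 < c)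
    (hκ : 2 < κ) : 0 < moment P 1 :=
  moment_pos hP one_ne_zero (by simpa using hA.integrable hP hc hκ) (hA.not_ae_eq_zero hP hc)

end PropertyA

/-! ### Convolution powers -/

section ConvPow

variable {f : ℕ → ℝ}

lemma convPow_nonneg (hf : ∀ r, 0 ≤ f r) (N r : ℕ) : 0 ≤ convPow f N r := by
  induction N generalizing r with
  | zero => simp only [convPow]; split_ifs <;> norm_num
  | succ N ih => exact Finset.sum_nonneg fun i _ => mul_nonneg (ih i) (hf _)

lemma hasSum_convPow (h1 : HasSum f 1) (N : ℕ) :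
    HasSum (convPow f N) 1 := by
  induction N with
  | zero => simpa only [convPow] using hasSum_ite_eq (0 : ℕ) (1 : ℝ)
  | succ N ih =>
    have := hasSum_sum_range_mul_of_summable_norm ih.summable.norm h1.summable.norm
    rwa [ih.tsum_eq, h1.tsum_eq, mul_one] at this

lemma convPow_le_one (hf : ∀ r, 0 ≤ f r) (h1 : HasSum f 1) (N r : ℕ) : convPow f N r ≤ 1 :=
  le_hasSum (hasSum_convPow h1 N) r fun _ _ => convPow_nonneg hf N _

/-- Any one of the `N` summands may be the large one. -/
lemma PowTail.convPow (h1 : HasSum f 1) {a L : ℝ} (ha : 1 < a)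
    (ht : PowTail f a L) (N : ℕ) : PowTail (convPow f N) a (N * L) := by
  induction N with
  | zero =>
    rw [Nat.cast_zero, zero_mul]
    refine Tendsto.congr' ?_ tendsto_const_nhds
    filter_upwards [eventually_gt_atTop 0] with r hr
    simp [Affiliation.convPow, hr.ne']
  | succ N ih =>
    have := ih.conv ha ht
    rw [(hasSum_convPow h1 N).tsum_eq, h1.tsum_eq] at this
    rw [mul_one, mul_one, add_comm, ← add_one_mul, ← Nat.cast_succ] at this
    exact this

/-- If a sum of `N` variables exceeds `N m`, then some summand exceeds `m`; hence a bound
`δ` on `f` beyond `m` gives the bound `N δ` on the `N`-fold convolution beyond `N m`. -/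
lemma convPow_le_of_tail_le (hf : ∀ r, 0 ≤ f r) (h1 : HasSum f 1) {m δ : ℝ}
    (hδ : 0 ≤ δ) (hfδ : ∀ r : ℕ, m ≤ r → f r ≤ δ) (N : ℕ) {r : ℕ}
    (hr : N * m < r) : convPow f N r ≤ N * δ := by
  induction N generalizing r with
  | zero =>
    have : r ≠ 0 := by rintro rfl; simp at hr
    simp [convPow, this]
  | succ N ih =>
    have hs : ∀ u : ℕ → ℝ, (∀ r, 0 ≤ u r) → HasSum u 1 →
        ∑ i ∈ Finset.range (r + 1), u i ≤ 1 := fun u hu hu1 =>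
      sum_le_hasSum _ (fun i _ => hu i) hu1
    have hterm : ∀ i ∈ Finset.range (r + 1), convPow f N i * f (r - i) ≤
        δ * convPow f N i + N * δ * f (r - i) := by
      intro i hi
      have hir : i ≤ r := by rw [Finset.mem_range] at hi; omega
      have h0 := convPow_nonneg hf N i
      have h2 := hf (r - i)
      have hNδ : 0 ≤ N * δ := by positivity
      rcases le_or_gt m ((r - i : ℕ) : ℝ) with h | h
      · nlinarith [mul_le_mul_of_nonneg_left (hfδ _ h) h0, mul_nonneg hNδ h2]
      · have h3 : convPow f N i ≤ N * δ := by
          refine ih ?_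
          rw [Nat.cast_sub hir] at h
          push_cast at hr
          linarith
        nlinarith [mul_le_mul_of_nonneg_right h3 h2, mul_nonneg hδ h0]
    have hrefl : ∑ i ∈ Finset.range (r + 1), f (r - i) ≤ 1 := by
      have := Finset.sum_range_reflect f (r + 1)
      simp only [Nat.add_sub_cancel] at this
      rw [this]
      exact hs f hf h1
    calc convPow f (N + 1) r
        ≤ ∑ i ∈ Finset.range (r + 1), (δ * convPow f N i + N * δ * f (r - i)) :=
          Finset.sum_le_sum hterm
      _ = δ * ∑ i ∈ Finset.range (r + 1), convPow f N i +
            N * δ * ∑ i ∈ Finset.range (r + 1), f (r - i) := by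
          rw [Finset.sum_add_distrib, Finset.mul_sum, Finset.mul_sum]
      _ ≤ δ * 1 + N * δ * 1 := by
          gcongr
          exact hs _ (convPow_nonneg hf N) (hasSum_convPow h1 N)
      _ = ((N + 1 : ℕ) : ℝ) * δ := by push_cast; ring

/-- A polynomial bound in `N` on the ratio of the `N`-fold convolution to the power tail: the
largest of `N` summands is at least the `N`-th part of the sum. -/
lemma exists_convPow_bound (hf : ∀ r, 0 ≤ f r) (h1 : HasSum f 1) {a L : ℝ} (ha : 0 ≤ a)
    (ht : PowTail f a L) : ∃ A : ℝ, 0 ≤ A ∧ ∀ N r : ℕ,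
      convPow f N r * ((r : ℝ) + 1) ^ a ≤ A * ((N : ℝ) + 1) ^ (a + 1) := by
  obtain ⟨C, hC1, hC⟩ := ht.bound
  have hC0 : 0 ≤ C := zero_le_one.trans hC1
  refine ⟨C, hC0, fun N r => ?_⟩
  rcases Nat.eq_zero_or_pos r with rfl | hr
  · have h2 : (1 : ℝ) ≤ ((N : ℝ) + 1) ^ (a + 1) :=
      Real.one_le_rpow (by simp) (by linarith)
    have h3 := convPow_le_one hf h1 N 0
    simp only [Nat.cast_zero, zero_add, Real.one_rpow, mul_one]
    nlinarith
  · have hr' : (0 : ℝ) < r := by exact_mod_cast hr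
    set δ := C * (((r : ℝ) + 1) / (N + 1)) ^ (-a) with hδ
    have hδ0 : 0 ≤ δ := by positivity
    have hb := convPow_le_of_tail_le hf h1 (m := r / (N + 1)) hδ0 (fun i hi => ?_) N (r := r) ?_
    · have e : δ * ((r : ℝ) + 1) ^ a = C * ((N : ℝ) + 1) ^ a := by
        rw [hδ, Real.div_rpow (by positivity) (by positivity), Real.rpow_neg (by positivity),
          Real.rpow_neg (by positivity)]
        field_simp
      calc convPow f N r * ((r : ℝ) + 1) ^ a ≤ N * δ * ((r : ℝ) + 1) ^ a := by gcongr
        _ = N * (C * ((N : ℝ) + 1) ^ a) := by rw [mul_assoc, e]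
        _ ≤ (N + 1) * (C * ((N : ℝ) + 1) ^ a) := by gcongr; linarith
        _ = C * ((N : ℝ) + 1) ^ (a + 1) := by
            rw [Real.rpow_add_one (by positivity)]; ring
    · refine ((le_abs_self _).trans (hC i)).trans ?_
      refine mul_le_mul_of_nonneg_left ?_ hC0
      refine Real.rpow_le_rpow_of_nonpos (by positivity) ?_ (by linarith)
      rw [div_le_iff₀ (by positivity)] at hi ⊢
      have : (0 : ℝ) ≤ N := by positivity
      nlinarith
    · rw [mul_div_assoc', div_lt_iff₀ (by positivity)]
      linarith

end ConvPow

/-! ### The degree laws -/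

section DegreeLaw

variable {P₁ P₂ : Measure ℝ} {β : ℝ}

lemma mixedPoisson_nonneg {P : Measure ℝ} (hP : ∀ᵐ z ∂P, 0 ≤ z) {s : ℝ} (hs : 0 ≤ s) (r : ℕ) :
    0 ≤ mixedPoisson P s r := by
  refine integral_nonneg_of_ae ?_
  filter_upwards [hP] with z hz
  exact poissonProb_nonneg (by positivity) r

lemma probTau_eq (hP₁ : ∀ᵐ x ∂P₁, 0 ≤ x) (hi₁ : Integrable (fun z => z) P₁)
    (hb : 0 < moment P₂ 1) (hβ : 0 < β) (r : ℕ) :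
    probTau P₁ P₂ β r = (moment P₂ 1 * β ^ (-(1 / 2 : ℝ)) * moment P₁ 1)⁻¹ *
      (((r : ℝ) + 1) * mixedPoisson P₁ (moment P₂ 1 * β ^ (-(1 / 2 : ℝ))) (r + 1)) := by
  have : meanOf (probLam0 P₁ P₂ β) = moment P₂ 1 * β ^ (-(1 / 2 : ℝ)) * moment P₁ 1 :=
    meanOf_mixedPoisson hP₁ hi₁ (by positivity)
  rw [probTau, this, probLam0]
  ring

lemma probTau_nonneg (hP₁ : ∀ᵐ x ∂P₁, 0 ≤ x) (hi₁ : Integrable (fun z => z) P₁)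
    (ha : 0 < moment P₁ 1) (hb : 0 < moment P₂ 1) (hβ : 0 < β) (r : ℕ) :
    0 ≤ probTau P₁ P₂ β r := by
  rw [probTau_eq hP₁ hi₁ hb hβ]
  have := mixedPoisson_nonneg hP₁ (s := moment P₂ 1 * β ^ (-(1 / 2 : ℝ))) (by positivity) (r + 1)
  positivity

lemma hasSum_probTau (hP₁ : ∀ᵐ x ∂P₁, 0 ≤ x) (hi₁ : Integrable (fun z => z) P₁)
    (ha : 0 < moment P₁ 1) (hb : 0 < moment P₂ 1) (hβ : 0 < β) :
    HasSum (probTau P₁ P₂ β) 1 := by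
  set s := moment P₂ 1 * β ^ (-(1 / 2 : ℝ)) with hs
  have hspos : 0 < s := by positivity
  have h := (hasSum_nat_add_iff' 1).mpr (hasSum_mul_mixedPoisson hP₁ hi₁ hspos.le)
  have h2 := h.mul_left (s * moment P₁ 1)⁻¹
  simp only [Finset.range_one, Finset.sum_singleton, Nat.cast_zero, zero_mul, sub_zero] at h2
  rw [inv_mul_cancel₀ (by positivity)] at h2
  refine h2.congr_fun fun r => ?_
  rw [probTau_eq hP₁ hi₁ hb hβ]
  push_cast
  rfl

/-- Conditioning on the number of summands: `q` is the mixture of the convolution powers of the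
law of `τ` with size-biased mixed Poisson weights. -/
lemma hasSum_q (hP₁ : ∀ᵐ x ∂P₁, 0 ≤ x) (hP₂ : ∀ᵐ y ∂P₂, 0 ≤ y)
    (hi₁ : Integrable (fun z => z) P₁) (hi₂ : Integrable (fun z => z) P₂)
    (ha : 0 < moment P₁ 1) (hb : 0 < moment P₂ 1) (hβ : 0 < β) (r : ℕ) :
    HasSum (fun N => sizeBiasedPoisson P₂ (moment P₁ 1 * β ^ (1 / 2 : ℝ)) N *
      convPow (probTau P₁ P₂ β) N r) (q P₁ P₂ β r) := by
  set s := moment P₁ 1 * β ^ (1 / 2 : ℝ) with hs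
  have hspos : 0 < s := by positivity
  have hτ0 := probTau_nonneg hP₁ hi₁ ha hb hβ
  have hτ1 := hasSum_probTau hP₁ hi₁ ha hb hβ
  have := hasSum_integral_of_dominated_convergence (μ := P₂)
    (F := fun N y => y * poissonProb (s * y) N * convPow (probTau P₁ P₂ β) N r)
    (f := fun y => y * probDstar P₁ P₂ β y r)
    (fun N y => y * poissonProb (s * y) N)
    (fun N => ((continuous_mul_poissonProb s N).mul continuous_const).aestronglyMeasurable)
    (fun N => ?_) ?_ ?_ ?_
  · refine this.congr_fun fun N => ?_
    rw [sizeBiasedPoisson, integral_mul_const]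
  · filter_upwards [hP₂] with y hy
    have h0 := mul_nonneg hy (poissonProb_nonneg (l := s * y) (by positivity) N)
    have h1 := convPow_nonneg hτ0 N r
    rw [Real.norm_eq_abs, abs_of_nonneg (mul_nonneg h0 h1)]
    exact mul_le_of_le_one_right h0 (convPow_le_one hτ0 hτ1 N r)
  · exact Eventually.of_forall fun y => (hasSum_poissonProb (s * y)).summable.mul_left y
  · refine hi₂.congr (Eventually.of_forall fun y => ?_)
    simp only [((hasSum_poissonProb (s * y)).mul_left y).tsum_eq, mul_one]
  · filter_upwards [hP₂] with y hy
    have hsum : Summable fun N => poissonProb (s * y) N * convPow (probTau P₁ P₂ β) N r := by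
      refine Summable.of_nonneg_of_le (fun N => ?_) (fun N => ?_)
        (hasSum_poissonProb (s * y)).summable
      · exact mul_nonneg (poissonProb_nonneg (by positivity) N) (convPow_nonneg hτ0 N r)
      · exact mul_le_of_le_one_right (poissonProb_nonneg (by positivity) N)
          (convPow_le_one hτ0 hτ1 N r)
    have h2 := hsum.hasSum.mul_left y
    rw [probDstar, show y * moment P₁ 1 * β ^ (1 / 2 : ℝ) = s * y by rw [hs]; ring]
    simpa only [mul_assoc] using h2

lemma q_nonneg (hP₁ : ∀ᵐ x ∂P₁, 0 ≤ x) (hP₂ : ∀ᵐ y ∂P₂, 0 ≤ y)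
    (hi₁ : Integrable (fun z => z) P₁) (hi₂ : Integrable (fun z => z) P₂)
    (ha : 0 < moment P₁ 1) (hb : 0 < moment P₂ 1) (hβ : 0 < β) (r : ℕ) :
    0 ≤ q P₁ P₂ β r :=
  (hasSum_q hP₁ hP₂ hi₁ hi₂ ha hb hβ r).nonneg fun N =>
    mul_nonneg (sizeBiasedPoisson_nonneg hP₂ (by positivity) N)
      (convPow_nonneg (probTau_nonneg hP₁ hi₁ ha hb hβ) N r)

lemma tsum_q (hP₁ : ∀ᵐ x ∂P₁, 0 ≤ x) (hP₂ : ∀ᵐ y ∂P₂, 0 ≤ y)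
    (hi₁ : Integrable (fun z => z) P₁) (hi₂ : Integrable (fun z => z) P₂)
    (ha : 0 < moment P₁ 1) (hb : 0 < moment P₂ 1) (hβ : 0 < β) :
    ∑' r, q P₁ P₂ β r = moment P₂ 1 := by
  set s := moment P₁ 1 * β ^ (1 / 2 : ℝ) with hs
  have hspos : 0 < s := by positivity
  have hτ0 := probTau_nonneg hP₁ hi₁ ha hb hβ
  have hτ1 := hasSum_probTau hP₁ hi₁ ha hb hβ
  have hw := hasSum_sizeBiasedPoisson hP₂ hi₂ hspos.le
  have hrow : ∀ N, HasSum (fun r => sizeBiasedPoisson P₂ s N * convPow (probTau P₁ P₂ β) N r)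
      (sizeBiasedPoisson P₂ s N) := fun N => by
    simpa using (hasSum_convPow hτ1 N).mul_left (sizeBiasedPoisson P₂ s N)
  have hsum : Summable (Function.uncurry fun N r =>
      sizeBiasedPoisson P₂ s N * convPow (probTau P₁ P₂ β) N r) := by
    refine (summable_prod_of_nonneg fun p => ?_).mpr ⟨fun N => (hrow N).summable, ?_⟩
    · exact mul_nonneg (sizeBiasedPoisson_nonneg hP₂ hspos.le _) (convPow_nonneg hτ0 _ _)
    · refine hw.summable.congr fun N => ?_
      exact (hrow N).tsum_eq.symm
  calc ∑' r, q P₁ P₂ β r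
      = ∑' r, ∑' N, sizeBiasedPoisson P₂ s N * convPow (probTau P₁ P₂ β) N r :=
        tsum_congr fun r => (hasSum_q hP₁ hP₂ hi₁ hi₂ ha hb hβ r).tsum_eq.symm
    _ = ∑' N, ∑' r, sizeBiasedPoisson P₂ s N * convPow (probTau P₁ P₂ β) N r := hsum.tsum_comm
    _ = moment P₂ 1 := by
        rw [← hw.tsum_eq]
        exact tsum_congr fun N => (hrow N).tsum_eq

/-! ### Light-tailed `Y` and heavy-tailed `X` -/

lemma poissonProb_mul_pow (l ρ : ℝ) (r : ℕ) :
    poissonProb l r * ρ ^ r = Real.exp ((ρ - 1) * l) * poissonProb (ρ * l) r := by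
  unfold poissonProb
  rw [mul_div_assoc', ← mul_assoc, ← Real.exp_add,
    show (ρ - 1) * l + -(ρ * l) = -l by ring, mul_pow]
  ring

lemma integrable_mul_exp {a b : ℝ} (hab : b < a) (hP₂ : ∀ᵐ y ∂P₂, 0 ≤ y)
    (he : Integrable (fun z : ℝ => Real.exp (a * z)) P₂) :
    Integrable (fun z => z * Real.exp (b * z)) P₂ := by
  refine (he.const_mul (a - b)⁻¹).mono' (by fun_prop) ?_
  filter_upwards [hP₂] with z hz
  rw [Real.norm_eq_abs, abs_of_nonneg (by positivity),
    show a * z = (a - b) * z + b * z by ring, Real.exp_add, ← mul_assoc]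
  refine mul_le_mul_of_nonneg_right ?_ (Real.exp_pos _).le
  have := Real.add_one_le_exp ((a - b) * z)
  have hab' : 0 < a - b := by linarith
  rw [inv_mul_eq_div, le_div_iff₀ hab']
  linarith

/-- All polynomial moments of the weights are finite when `Y` has an exponential moment. -/
lemma summable_sizeBiasedPoisson_mul_rpow {a s : ℝ} (ha : 0 < a) (hs : 0 < s)
    (hP₂ : ∀ᵐ y ∂P₂, 0 ≤ y) (he : Integrable (fun z : ℝ => Real.exp (a * z)) P₂) (p : ℝ) :
    Summable fun N : ℕ => sizeBiasedPoisson P₂ s N * ((N : ℝ) + 1) ^ p := by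
  -- The weights times `ρ ^ N` sum to `E (Y e ^ (s (ρ - 1) Y))`, and `s (ρ - 1) = a / 2 < a`.
  set ρ := 1 + a / (2 * s) with hρ
  have hρ1 : 1 < ρ := by
    have : 0 < a / (2 * s) := by positivity
    rw [hρ]
    linarith
  have hρ0 : 0 < ρ := by linarith
  have h1 : Summable fun N : ℕ => sizeBiasedPoisson P₂ s N * ρ ^ N := by
    have := hasSum_integral_of_nonneg (P := P₂)
      (F := fun N y => y * poissonProb (s * y) N * ρ ^ N)
      (G := fun y => y * Real.exp (a / 2 * y))
      (fun N => (continuous_mul_poissonProb s N).mul continuous_const)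
      (by
        filter_upwards [hP₂] with y hy N
        have := poissonProb_nonneg (l := s * y) (by positivity) N
        positivity)
      (Eventually.of_forall fun y => by
        have h := (hasSum_poissonProb (ρ * (s * y))).mul_left (y * Real.exp ((ρ - 1) * (s * y)))
        rw [mul_one] at h
        have e : (ρ - 1) * (s * y) = a / 2 * y := by rw [hρ]; field_simp; ring
        rw [e] at h
        refine h.congr_fun fun N => ?_
        rw [mul_assoc, poissonProb_mul_pow, e]
        ring)
      (integrable_mul_exp (by linarith) hP₂ he)
    refine this.summable.congr fun N => ?_
    rw [integral_mul_const, sizeBiasedPoisson]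
  have h2 : ∃ C : ℝ, ∀ N : ℕ, ((N : ℝ) + 1) ^ p ≤ C * ρ ^ N := by
    obtain ⟨n, hn⟩ := exists_nat_ge p
    have h3 := (tendsto_pow_const_mul_const_pow_of_abs_lt_one n (r := ρ⁻¹) (by
      rw [abs_of_pos (by positivity)]
      exact inv_lt_one_of_one_lt₀ hρ1))
    obtain ⟨C, hC⟩ := (Metric.isBounded_range_of_tendsto _ h3).exists_norm_le
    refine ⟨C * ρ, fun N => ?_⟩
    have h4 := (le_abs_self _).trans (hC _ ⟨N + 1, rfl⟩)
    push_cast at h4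
    rw [inv_pow, ← div_eq_mul_inv, div_le_iff₀ (by positivity)] at h4
    calc ((N : ℝ) + 1) ^ p ≤ ((N : ℝ) + 1) ^ (n : ℝ) :=
          Real.rpow_le_rpow_of_exponent_le (by simp) hn
      _ = ((N : ℝ) + 1) ^ n := Real.rpow_natCast _ _
      _ ≤ C * ρ ^ (N + 1) := h4
      _ = C * ρ * ρ ^ N := by rw [pow_succ]; ring
  obtain ⟨C, hC⟩ := h2
  refine Summable.of_nonneg_of_le (fun N => ?_) (fun N => ?_) (h1.mul_left C)
  · exact mul_nonneg (sizeBiasedPoisson_nonneg hP₂ hs.le N) (by positivity)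
  · rw [mul_left_comm]
    exact mul_le_mul_of_nonneg_left (hC N) (sizeBiasedPoisson_nonneg hP₂ hs.le N)

lemma integrable_of_exp {a : ℝ} (ha : 0 < a) (hP₂ : ∀ᵐ y ∂P₂, 0 ≤ y)
    (he : Integrable (fun z : ℝ => Real.exp (a * z)) P₂) : Integrable (fun z => z) P₂ := by
  simpa using integrable_mul_exp ha hP₂ he

lemma integrable_sq_of_exp {a : ℝ} (ha : 0 < a) (hP₂ : ∀ᵐ y ∂P₂, 0 ≤ y)
    (he : Integrable (fun z : ℝ => Real.exp (a * z)) P₂) :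
    Integrable (fun z => z ^ 2) P₂ := by
  have h := (integrable_mul_exp (b := a / 2) (by linarith) hP₂ he).const_mul (2 / a)
  refine h.mono' (by fun_prop) ?_
  filter_upwards [hP₂] with z hz
  rw [Real.norm_eq_abs, abs_of_nonneg (by positivity), mul_left_comm, sq]
  refine mul_le_mul_of_nonneg_left ?_ hz
  have := Real.add_one_le_exp (a / 2 * z)
  rw [div_mul_eq_mul_div, le_div_iff₀ ha]
  linarith

lemma hasSum_nat_mul_sizeBiasedPoisson {s : ℝ} (hs : 0 ≤ s) (hP₂ : ∀ᵐ y ∂P₂, 0 ≤ y)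
    (hi : Integrable (fun z => z ^ 2) P₂) :
    HasSum (fun N : ℕ => sizeBiasedPoisson P₂ s N * N) (s * moment P₂ 2) := by
  have := hasSum_integral_of_nonneg (P := P₂)
    (F := fun (N : ℕ) y => y * poissonProb (s * y) N * N) (G := fun y => s * y ^ 2)
    (fun N => (continuous_mul_poissonProb s N).mul continuous_const)
    (by
      filter_upwards [hP₂] with y hy N
      have := poissonProb_nonneg (l := s * y) (by positivity) N
      positivity)
    (Eventually.of_forall fun y => by
      rw [← hasSum_nat_add_iff' 1]
      have h := (hasSum_poissonProb (s * y)).mul_left (s * y ^ 2)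
      simp only [Finset.range_one, Finset.sum_singleton, Nat.cast_zero, mul_zero, sub_zero]
      rw [mul_one] at h
      refine h.congr_fun fun N => ?_
      have := succ_mul_poissonProb (s * y) N
      push_cast
      calc _ = y * (((N : ℝ) + 1) * poissonProb (s * y) (N + 1)) := by ring
        _ = _ := by rw [this]; ring)
    (hi.const_mul s)
  rw [integral_const_mul] at this
  refine this.congr_fun fun N => ?_
  rw [integral_mul_const, sizeBiasedPoisson]

/-- When `X` is heavy-tailed and `Y` is not, a large value of the compound Poisson variable is due
to one large summand `τ_j`. -/
lemma powTail_q_of_exp [IsProbabilityMeasure P₁] {c κ a : ℝ} (hP₁ : ∀ᵐ x ∂P₁, 0 ≤ x)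
    (hP₂ : ∀ᵐ y ∂P₂, 0 ≤ y) (hc : 0 < c) (hκ : 2 < κ) (hA : PropertyA P₁ c κ) (ha : 0 < a)
    (he : Integrable (fun z : ℝ => Real.exp (a * z)) P₂) (h0 : ¬ ∀ᵐ z ∂P₂, z = 0)
    (hβ : 0 < β) : PowTail (q P₁ P₂ β) (κ - 1) (cStar2 P₂ β c κ) := by
  have hi₁ := hA.integrable hP₁ hc hκ
  have hi₂ := integrable_of_exp ha hP₂ he
  have ha₁ := hA.moment_one_pos hP₁ hc hκ
  have hb : 0 < moment P₂ 1 := moment_pos hP₂ one_ne_zero (by simpa using hi₂) h0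
  have hτ0 := probTau_nonneg hP₁ hi₁ ha₁ hb hβ
  have hτ1 := hasSum_probTau hP₁ hi₁ ha₁ hb hβ
  set s₀ := moment P₂ 1 * β ^ (-(1 / 2 : ℝ)) with hs₀
  set s := moment P₁ 1 * β ^ (1 / 2 : ℝ) with hs
  have hs₀pos : 0 < s₀ := by positivity
  have hspos : 0 < s := by positivity
  set L := (s₀ * moment P₁ 1)⁻¹ * (c * s₀ ^ (κ - 1)) with hL
  have hτ : PowTail (probTau P₁ P₂ β) (κ - 1) L := by
    refine Tendsto.congr (fun r => ?_)
      ((hA.powTail_succ_mul_mixedPoisson hP₁ hc hs₀pos).const_mul (s₀ * moment P₁ 1)⁻¹)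
    rw [probTau_eq hP₁ hi₁ hb hβ]
  obtain ⟨A, hA0, hAb⟩ := exists_convPow_bound hτ0 hτ1 (by linarith) hτ
  have key := tendsto_tsum_of_dominated_convergence (𝓕 := (atTop : Filter ℕ))
    (f := fun r N => sizeBiasedPoisson P₂ s N *
      (convPow (probTau P₁ P₂ β) N r * ((r : ℝ) + 1) ^ (κ - 1)))
    (g := fun N => sizeBiasedPoisson P₂ s N * (N * L))
    (bound := fun N => A * (sizeBiasedPoisson P₂ s N * ((N : ℝ) + 1) ^ (κ - 1 + 1)))
    ((summable_sizeBiasedPoisson_mul_rpow ha hspos hP₂ he _).mul_left A)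
    (fun N => Tendsto.const_mul _ (hτ.convPow hτ1 (by linarith) N))
    (Eventually.of_forall fun r N => by
      have hw := sizeBiasedPoisson_nonneg hP₂ hspos.le N
      have hn := convPow_nonneg hτ0 N r
      rw [Real.norm_eq_abs, abs_of_nonneg (by positivity), mul_left_comm A]
      exact mul_le_mul_of_nonneg_left (hAb N r) hw)
  have hlim : ∑' N : ℕ, sizeBiasedPoisson P₂ s N * (N * L) = cStar2 P₂ β c κ := by
    have h1 := (hasSum_nat_mul_sizeBiasedPoisson hspos.le hP₂
      (integrable_sq_of_exp ha hP₂ he)).mul_right L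
    simp only [← mul_assoc]
    rw [h1.tsum_eq, hL, hs, cStar2]
    have e1 : s₀ ^ (κ - 1) = s₀ ^ (κ - 2) * s₀ := by
      rw [← Real.rpow_add_one hs₀pos.ne']; congr 1; ring
    have e2 : s₀ ^ (κ - 2) = moment P₂ 1 ^ (κ - 2) * β ^ (-(1 / 2) * (κ - 2)) := by
      rw [hs₀, Real.mul_rpow hb.le (by positivity), ← Real.rpow_mul hβ.le]
    have e3 : β ^ ((3 - κ) / 2) = β ^ (-(1 / 2) * (κ - 2)) * β ^ (1 / 2 : ℝ) := by
      rw [← Real.rpow_add hβ]; congr 1; ring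
    rw [e1, e2, e3]
    field_simp
  rw [hlim] at key
  refine key.congr fun r => ?_
  rw [← (hasSum_q hP₁ hP₂ hi₁ hi₂ ha₁ hb hβ r).tsum_eq, ← tsum_mul_right]
  exact tsum_congr fun N => by ring

/-! ### Heavy-tailed `Y` and constant `X` -/

/-- The sum of `N` independent Poisson variables of mean `l` is Poisson of mean `l N`. -/
lemma convPow_poissonProb (l : ℝ) (N r : ℕ) :
    convPow (poissonProb l) N r = poissonProb (l * N) r := by
  induction N generalizing r with
  | zero =>
    simp only [convPow, poissonProb, Nat.cast_zero, mul_zero, neg_zero, Real.exp_zero, one_mul]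
    split_ifs with h <;> simp [h]
  | succ N ih =>
    simp only [convPow, ih]
    unfold poissonProb
    have e : l * ((N + 1 : ℕ) : ℝ) = l * N + l := by push_cast; ring
    rw [e, add_pow, mul_div_assoc, Finset.sum_div, Finset.mul_sum]
    refine Finset.sum_congr rfl fun i hi => ?_
    have hir : i ≤ r := by rw [Finset.mem_range] at hi; omega
    rw [Nat.cast_choose ℝ hir, neg_add, Real.exp_add]
    have h1 : (r.factorial : ℝ) ≠ 0 := by positivity
    field_simp

lemma moment_dirac (x : ℝ) (i : ℕ) : moment (Measure.dirac x) i = x ^ i := by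
  simp [moment]

lemma mixedPoisson_dirac (x s : ℝ) (r : ℕ) :
    mixedPoisson (Measure.dirac x) s r = poissonProb (s * x) r := by
  simp [mixedPoisson]

/-- For a constant `X` the compound Poisson law is a Poisson mixture twice over, first in the
number of summands and then in their sum, and each mixture preserves the power tail. -/
lemma powTail_q_dirac [IsProbabilityMeasure P₂] {c κ x : ℝ} (hP₂ : ∀ᵐ y ∂P₂, 0 ≤ y)
    (hc : 0 < c) (hκ : 2 < κ) (hx : 0 < x) (hA : PropertyA P₂ c κ) (hβ : 0 < β) :
    PowTail (q (Measure.dirac x) P₂ β) (κ - 1) (c * (x ^ 2 * moment P₂ 1) ^ (κ - 2)) := by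
  have hi₂ := hA.integrable hP₂ hc hκ
  have hb := hA.moment_one_pos hP₂ hc hκ
  have hP₁ : ∀ᵐ z ∂(Measure.dirac x), 0 ≤ z := by
    rw [ae_dirac_eq]; exact hx.le
  have hi₁ : Integrable (fun z => z) (Measure.dirac x) := integrable_dirac (by simp)
  have ha : 0 < moment (Measure.dirac x) 1 := by rw [moment_dirac, pow_one]; exact hx
  set s₀ := moment P₂ 1 * β ^ (-(1 / 2 : ℝ)) * x with hs₀
  set s := moment (Measure.dirac x) 1 * β ^ (1 / 2 : ℝ) with hs
  have hs₀pos : 0 < s₀ := by positivity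
  have hspos : 0 < s := by positivity
  have hτ : probTau (Measure.dirac x) P₂ β = poissonProb s₀ := by
    funext r
    rw [probTau_eq hP₁ hi₁ hb hβ, mixedPoisson_dirac, moment_dirac, pow_one, ← hs₀,
      succ_mul_poissonProb]
    field_simp
  have hw := hA.powTail_sizeBiasedPoisson hP₂ hc hspos
  have h1 := powTail_nat_mixture hs₀pos hw (hw.summable_abs (by linarith))
  have e : c * s ^ (κ - 2) * s₀ ^ (κ - 1 - 1) = c * (x ^ 2 * moment P₂ 1) ^ (κ - 2) := by
    rw [show κ - 1 - 1 = κ - 2 by ring, mul_assoc, ← Real.mul_rpow hspos.le hs₀pos.le]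
    congr 2
    rw [hs, hs₀, moment_dirac, pow_one, Real.rpow_neg hβ.le]
    have : β ^ (1 / 2 : ℝ) ≠ 0 := by positivity
    field_simp
  rw [e] at h1
  refine Tendsto.congr (fun r => ?_) h1
  congr 1
  rw [← (hasSum_q hP₁ hP₂ hi₁ hi₂ ha hb hβ r).tsum_eq, hτ]
  refine tsum_congr fun N => ?_
  rw [convPow_poissonProb, mul_comm]

end DegreeLaw

/-! ### Degree-degree asymptotics -/

lemma isEquivalent_of_tendsto_prod {F : ℕ × ℕ → ℝ} {a b L : ℝ} (hL : L ≠ 0)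
    (h : Tendsto (fun k : ℕ × ℕ => F k * ((k.1 : ℝ) + 1) ^ a * ((k.2 : ℝ) + 1) ^ b)
      (atTop ×ˢ atTop) (𝓝 L)) :
    F ~[atTop ×ˢ atTop] fun k => L * ((k.1 : ℝ) ^ (-a) * (k.2 : ℝ) ^ (-b)) := by
  have h1 := (tendsto_natCast_ratio_rpow (-a)).comp
    (tendsto_fst (f := (atTop : Filter ℕ)) (g := (atTop : Filter ℕ)))
  have h2 := (tendsto_natCast_ratio_rpow (-b)).comp
    (tendsto_snd (f := (atTop : Filter ℕ)) (g := (atTop : Filter ℕ)))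
  have hpos : ∀ᶠ k : ℕ × ℕ in atTop ×ˢ atTop, (0 : ℝ) < k.1 ∧ (0 : ℝ) < k.2 := by
    filter_upwards [tendsto_fst.eventually (eventually_gt_atTop 0),
      tendsto_snd.eventually (eventually_gt_atTop 0)] with k hk1 hk2
    exact ⟨by exact_mod_cast hk1, by exact_mod_cast hk2⟩
  refine isEquivalent_of_tendsto hL ?_ ?_
  · filter_upwards [hpos] with k ⟨hk1, hk2⟩
    positivity
  · have h3 := (h.mul h1).mul h2
    rw [mul_one, mul_one] at h3
    refine h3.congr' ?_
    filter_upwards [hpos] with k ⟨hk1, hk2⟩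
    simp only [Function.comp_apply]
    rw [Real.div_rpow (by positivity) (by positivity),
      Real.div_rpow (by positivity) (by positivity), Real.rpow_neg (by positivity) a,
      Real.rpow_neg (by positivity) b]
    field_simp

/-- Dominated convergence for a sum in which one factor decays fast: both power-tailed factors may
then be replaced by their values at `k₁` and `k₂`, because `(k - r + 1) (r + 1) ≥ k + 1`. -/
lemma tendsto_light_sum {h q : ℕ → ℝ} {a Q : ℝ} (ha : 0 ≤ a)
    (hh : Summable fun r : ℕ => |h r| * ((r : ℝ) + 1) ^ (a + a)) (hq : PowTail q a Q) :
    Tendsto (fun k : ℕ × ℕ => (∑ r ∈ Finset.range (min k.1 k.2 + 1),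
        h r * q (k.1 - r) * q (k.2 - r)) * ((k.1 : ℝ) + 1) ^ a * ((k.2 : ℝ) + 1) ^ a)
      (atTop ×ˢ atTop) (𝓝 ((∑' r, h r) * Q * Q)) := by
  obtain ⟨C, hC1, hC⟩ := hq.bound
  have hC0 : 0 ≤ C := zero_le_one.trans hC1
  have hqb : ∀ k r : ℕ, r ≤ k → |q (k - r) * ((k : ℝ) + 1) ^ a| ≤ C * ((r : ℝ) + 1) ^ a := by
    intro k r hrk
    have h1 : ((k : ℝ) + 1) ^ a ≤ (((k - r : ℕ) : ℝ) + 1) ^ a * ((r : ℝ) + 1) ^ a := by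
      rw [← Real.mul_rpow (by positivity) (by positivity)]
      refine Real.rpow_le_rpow (by positivity) ?_ ha
      rw [Nat.cast_sub hrk]
      have h2 : (r : ℝ) ≤ k := by exact_mod_cast hrk
      have h3 : (0 : ℝ) ≤ r := by positivity
      nlinarith
    rw [abs_mul, abs_of_pos (by positivity : (0 : ℝ) < ((k : ℝ) + 1) ^ a)]
    calc |q (k - r)| * ((k : ℝ) + 1) ^ a
        ≤ (C * (((k - r : ℕ) : ℝ) + 1) ^ (-a)) *
            ((((k - r : ℕ) : ℝ) + 1) ^ a * ((r : ℝ) + 1) ^ a) := by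
          gcongr
          exact hC _
      _ = C * ((r : ℝ) + 1) ^ a := by
          rw [Real.rpow_neg (by positivity)]
          field_simp
  have key : Tendsto (fun k : ℕ × ℕ => ∑' r, if r ≤ min k.1 k.2 then
      h r * (q (k.1 - r) * ((k.1 : ℝ) + 1) ^ a) * (q (k.2 - r) * ((k.2 : ℝ) + 1) ^ a) else 0)
      (atTop ×ˢ atTop) (𝓝 (∑' r, h r * Q * Q)) := by
    refine tendsto_tsum_of_dominated_convergence
      (bound := fun r => C * C * (|h r| * ((r : ℝ) + 1) ^ (a + a))) (hh.mul_left _) (fun r => ?_) ?_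
    · have h1 := ((hq.tendsto_sub r).comp (tendsto_fst (f := (atTop : Filter ℕ))
        (g := (atTop : Filter ℕ)))).const_mul (h r)
      have h2 := (hq.tendsto_sub r).comp (tendsto_snd (f := (atTop : Filter ℕ))
        (g := (atTop : Filter ℕ)))
      refine (h1.mul h2).congr' ?_
      filter_upwards [tendsto_fst.eventually (eventually_ge_atTop r),
        tendsto_snd.eventually (eventually_ge_atTop r)] with k hk1 hk2
      rw [if_pos (le_min hk1 hk2)]
      rfl
    · refine Eventually.of_forall fun k r => ?_
      split_ifs with hr
      · have h1 := hqb k.1 r (hr.trans (min_le_left _ _))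
        have h2 := hqb k.2 r (hr.trans (min_le_right _ _))
        rw [Real.norm_eq_abs, abs_mul, abs_mul, Real.rpow_add (by positivity)]
        calc _ ≤ |h r| * (C * ((r : ℝ) + 1) ^ a) * (C * ((r : ℝ) + 1) ^ a) := by gcongr
          _ = _ := by ring
      · rw [norm_zero]; positivity
  rw [tsum_mul_right, tsum_mul_right] at key
  refine key.congr fun k => ?_
  rw [tsum_eq_sum (s := Finset.range (min k.1 k.2 + 1)) fun r hr => if_neg fun h' => hr
    (Finset.mem_range.mpr (Nat.lt_succ_of_le h')), Finset.sum_mul, Finset.sum_mul]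
  refine Finset.sum_congr rfl fun r hr => ?_
  rw [if_pos (Nat.lt_succ_iff.mp (Finset.mem_range.mp hr))]
  ring

lemma summable_poissonProb_mul_rpow (l p : ℝ) :
    Summable fun r : ℕ => |poissonProb l r| * ((r : ℝ) + 1) ^ p := by
  have h : PowTail (fun r => l ^ r / (r.factorial : ℝ) * ((r : ℝ) + 1) ^ p) 2 0 := by
    refine Tendsto.congr (fun r => ?_) (powTail_pow_div_factorial l (p + 2))
    rw [Real.rpow_add (by positivity), mul_assoc]
  refine ((h.summable_abs one_lt_two).mul_left (Real.exp (-l))).congr fun r => ?_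
  rw [poissonProb, mul_div_assoc, abs_mul, abs_mul, abs_of_pos (Real.exp_pos _),
    abs_of_pos (by positivity : (0 : ℝ) < ((r : ℝ) + 1) ^ p), mul_assoc]

/-- The sum `S_β (k, k + d)` in terms of the index `i = k - r` of `q`. -/
lemma degSum_add (P₁ P₂ : Measure ℝ) (β : ℝ) (k d : ℕ) :
    degSum P₁ P₂ β k (k + d) = ∑ i ∈ Finset.range (k + 1),
      (((k - i : ℕ) : ℝ) + 1) * (((k - i : ℕ) : ℝ) + 2) * probLam0 P₁ P₂ β (k - i + 2) *
        (q P₁ P₂ β i * q P₁ P₂ β (d + i)) := by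
  rw [degSum, min_eq_left (Nat.le_add_right k d), ← Finset.sum_range_reflect]
  refine Finset.sum_congr rfl fun i hi => ?_
  rw [Finset.mem_range] at hi
  rw [show k + 1 - 1 - i = k - i by omega, show k - (k - i) = i by omega,
    show k + d - (k - i) = d + i by omega]
  ring

section DegreeSum

variable {P₁ P₂ : Measure ℝ} [IsProbabilityMeasure P₁] {β c κ : ℝ}

lemma powTail_second_factorial (hP₁ : ∀ᵐ x ∂P₁, 0 ≤ x) (hc : 0 < c) (hA : PropertyA P₁ c κ)
    (hb : 0 < moment P₂ 1) (hβ : 0 < β) :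
    PowTail (fun r : ℕ => ((r : ℝ) + 1) * ((r : ℝ) + 2) * probLam0 P₁ P₂ β (r + 2)) (κ - 2)
      (cStar1 P₂ β c κ) := by
  have hs : 0 < moment P₂ 1 * β ^ (-(1 / 2 : ℝ)) := by positivity
  have h := ((hA.powTail_succ_mul_mixedPoisson hP₁ hc hs).shift 1).succ_mul
  rw [show κ - 1 - 1 = κ - 2 by ring] at h
  refine Tendsto.congr (fun r => ?_) h
  simp only [probLam0]
  push_cast
  ring

lemma powTail_degSum (hP₁ : ∀ᵐ x ∂P₁, 0 ≤ x) (hc : 0 < c) (hκ : 2 < κ) (hA : PropertyA P₁ c κ)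
    (hb : 0 < moment P₂ 1) (hβ : 0 < β) {Q : ℝ} (hq : PowTail (q P₁ P₂ β) (κ - 1) Q) (d : ℕ) :
    PowTail (fun k => degSum P₁ P₂ β k (k + d)) (κ - 2)
      (cStar1 P₂ β c κ * cStar3 P₁ P₂ β d) := by
  obtain ⟨D, hD⟩ := (Metric.isBounded_range_of_tendsto _
    (hq.tendsto_zero (by linarith))).exists_norm_le
  have := tendsto_degree_sum (l := atTop) (k := fun k : ℕ => k) tendsto_id (by linarith)
    (powTail_second_factorial hP₁ hc hA hb hβ) (q := q P₁ P₂ β) (Q := Q)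
    (by rwa [show κ - 2 + 1 = κ - 1 by ring])
    (g := fun _ i => q P₁ P₂ β (d + i)) (G := fun i => q P₁ P₂ β (d + i))
    (D := D) (Eventually.of_forall fun _ i => hD _ ⟨_, rfl⟩) (fun i => tendsto_const_nhds)
  refine this.congr fun k => ?_
  beta_reduce
  rw [degSum_add]

lemma tendsto_degSum_prod (hP₁ : ∀ᵐ x ∂P₁, 0 ≤ x) (hc : 0 < c) (hκ : 2 < κ)
    (hA : PropertyA P₁ c κ) (hb : 0 < moment P₂ 1) (hβ : 0 < β) {Q : ℝ}
    (hq : PowTail (q P₁ P₂ β) (κ - 1) Q) (hsum : ∑' i, q P₁ P₂ β i = moment P₂ 1) :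
    Tendsto (fun k : ℕ × ℕ => degSum P₁ P₂ β k.1 (k.1 + k.2) * ((k.1 : ℝ) + 1) ^ (κ - 2) *
      ((k.2 : ℝ) + 1) ^ (κ - 1)) (atTop ×ˢ atTop)
      (𝓝 (moment P₂ 1 * cStar1 P₂ β c κ * Q)) := by
  obtain ⟨C, hC1, hC⟩ := hq.bound
  have := tendsto_degree_sum (l := (atTop : Filter ℕ) ×ˢ (atTop : Filter ℕ)) (k := Prod.fst)
    tendsto_fst (by linarith)
    (powTail_second_factorial hP₁ hc hA hb hβ) (q := q P₁ P₂ β) (Q := Q)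
    (by rwa [show κ - 2 + 1 = κ - 1 by ring])
    (g := fun k i => q P₁ P₂ β (k.2 + i) * ((k.2 : ℝ) + 1) ^ (κ - 1)) (G := fun _ => Q)
    (D := C) (Eventually.of_forall fun k i => ?_) (fun i => Tendsto.comp (hq.shift i) tendsto_snd)
  · rw [tsum_mul_right, hsum] at this
    rw [show moment P₂ 1 * cStar1 P₂ β c κ * Q = cStar1 P₂ β c κ * (moment P₂ 1 * Q) by ring]
    refine this.congr fun k => ?_
    rw [degSum_add, Finset.sum_mul, Finset.sum_mul, Finset.sum_mul]
    exact Finset.sum_congr rfl fun i _ => by ring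
  · have hp : (0 : ℝ) < ((k.2 : ℝ) + 1) ^ (κ - 1) := by positivity
    rw [abs_mul, abs_of_pos hp]
    calc _ ≤ C * (((k.2 + i : ℕ) : ℝ) + 1) ^ (-(κ - 1)) * ((k.2 : ℝ) + 1) ^ (κ - 1) := by
          gcongr; exact hC _
      _ ≤ C * ((k.2 : ℝ) + 1) ^ (-(κ - 1)) * ((k.2 : ℝ) + 1) ^ (κ - 1) := by
          gcongr ?_ * ?_ * _
          refine Real.rpow_le_rpow_of_nonpos (by positivity) ?_ (by linarith)
          push_cast
          linarith [i.cast_nonneg (α := ℝ)]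
      _ = C := by
          rw [Real.rpow_neg (by positivity)]
          field_simp

end DegreeSum

lemma powTail_pTilde {P₁ P₂ : Measure ℝ} [IsProbabilityMeasure P₂] {c κ : ℝ}
    (hP₂ : ∀ᵐ y ∂P₂, 0 ≤ y) (hc : 0 < c) (hκ : 2 < κ) (ha : 0 < moment P₁ 2)
    (hA : PropertyA P₂ c κ) :
    PowTail (fun k => pTilde P₁ P₂ (k + 1)) (κ - 1)
      (c * moment P₁ 2 ^ (κ - 2) * moment P₂ 1 ^ (κ - 3)) := by
  have hb := hA.moment_one_pos hP₂ hc hκ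
  set s := moment P₁ 2 * moment P₂ 1 with hs
  have hspos : 0 < s := by positivity
  have h := (hA.powTail_succ_mul_mixedPoisson hP₂ hc hspos).const_mul (s * moment P₂ 1)⁻¹
  have e : (s * moment P₂ 1)⁻¹ * (c * s ^ (κ - 1)) =
      c * moment P₁ 2 ^ (κ - 2) * moment P₂ 1 ^ (κ - 3) := by
    rw [show κ - 1 = κ - 2 + 1 by ring, Real.rpow_add_one hspos.ne', hs,
      Real.mul_rpow ha.le hb.le, show κ - 2 = κ - 3 + 1 by ring, Real.rpow_add_one hb.ne']
    field_simp
  rw [e] at h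
  refine Tendsto.congr (fun r => ?_) h
  have hm : meanOf (probLam3 P₁ P₂) = s * moment P₂ 1 :=
    meanOf_mixedPoisson hP₂ (hA.integrable hP₂ hc hκ) hspos.le
  simp only [pTilde, hm, probLam3]
  push_cast
  ring

end Affiliation
end

open Affiliation
theorem corollary1 (P₁ P₂ : Measure ℝ) [IsProbabilityMeasure P₁] [IsProbabilityMeasure P₂]
    (hP₁ : ∀ᵐ x ∂P₁, 0 ≤ x) (hP₂ : ∀ᵐ y ∂P₂, 0 ≤ y)
    (c x κ : ℝ) (hc : 0 < c) (hx : 0 < x) (hκ : 2 < κ) :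
    -- (i)
    (Integrable (fun z : ℝ => z ^ 2) P₁ → ¬ (∀ᵐ z ∂P₁, z = 0) → PropertyA P₂ c κ →
      (fun k : ℕ × ℕ => pInfty P₁ P₂ k.1 k.2) ~[atTop ×ˢ atTop]
        (fun k : ℕ × ℕ => c ^ 2 * moment P₁ 2 ^ (2 * κ - 4) * moment P₂ 1 ^ (2 * κ - 6) *
          ((k.1 : ℝ) * (k.2 : ℝ)) ^ (1 - κ))) ∧
    -- (ii), with k₁ = k, k₂ = k + d
    (∀ β : ℝ, 0 < β → (∃ a : ℝ, 0 < a ∧ Integrable (fun z : ℝ => Real.exp (a * z)) P₂) →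
      ¬ (∀ᵐ z ∂P₂, z = 0) → PropertyA P₁ c κ →
      (fun r : ℕ => q P₁ P₂ β r) ~[atTop] (fun r : ℕ => cStar2 P₂ β c κ * (r : ℝ) ^ (1 - κ)) ∧
      (∀ d : ℕ, Summable (fun i : ℕ => q P₁ P₂ β i * q P₁ P₂ β (d + i))) ∧
      -- the sum that defines p_β up to its normalizing factor, for every κ > 2
      ((fun k : ℕ × ℕ => degSum P₁ P₂ β k.1 (k.1 + k.2)) ~[atTop ×ˢ atTop]
        (fun k : ℕ × ℕ => moment P₂ 1 * cStar1 P₂ β c κ * cStar2 P₂ β c κ *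
          (k.1 : ℝ) ^ (2 - κ) * (k.2 : ℝ) ^ (1 - κ))) ∧
      (∀ d : ℕ, (fun k : ℕ => degSum P₁ P₂ β k (k + d)) ~[atTop]
        (fun k : ℕ => cStar1 P₂ β c κ * cStar3 P₁ P₂ β d * (k : ℝ) ^ (2 - κ))) ∧
      -- p_β itself, which is defined when a_2 is finite
      (Integrable (fun z : ℝ => z ^ 2) P₁ →
        ((fun k : ℕ × ℕ => pBeta P₁ P₂ β k.1 (k.1 + k.2)) ~[atTop ×ˢ atTop]
          (fun k : ℕ × ℕ => β / (moment P₂ 1 ^ 4 * moment P₁ 2) *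
            (moment P₂ 1 * cStar1 P₂ β c κ * cStar2 P₂ β c κ *
              (k.1 : ℝ) ^ (2 - κ) * (k.2 : ℝ) ^ (1 - κ)))) ∧
        (∀ d : ℕ, (fun k : ℕ => pBeta P₁ P₂ β k (k + d)) ~[atTop]
          (fun k : ℕ => β / (moment P₂ 1 ^ 4 * moment P₁ 2) *
            (cStar1 P₂ β c κ * cStar3 P₁ P₂ β d * (k : ℝ) ^ (2 - κ)))))) ∧
    -- (iii)
    (∀ β : ℝ, 0 < β → P₁ = Measure.dirac x → PropertyA P₂ c κ →
      (fun k : ℕ × ℕ => pBeta P₁ P₂ β k.1 k.2) ~[atTop ×ˢ atTop]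
        (fun k : ℕ × ℕ => c ^ 2 * x ^ (4 * κ - 8) * moment P₂ 1 ^ (2 * κ - 6) *
          ((k.1 : ℝ) * (k.2 : ℝ)) ^ (1 - κ))) := by
  refine ⟨fun hi h0 hA => ?_, fun β hβ ⟨a, ha, he⟩ h0 hA => ?_, fun β hβ hP hA => ?_⟩
  · have ha := moment_pos hP₁ two_ne_zero hi h0
    have hb := hA.moment_one_pos hP₂ hc hκ
    have h := powTail_pTilde hP₂ hc hκ ha hA
    have h1 := (Tendsto.comp h (tendsto_fst (g := (atTop : Filter ℕ)))).mul
      (Tendsto.comp h (tendsto_snd (f := (atTop : Filter ℕ))))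
    have h2 := isEquivalent_of_tendsto_prod (F := fun k => pInfty P₁ P₂ k.1 k.2)
      (a := κ - 1) (b := κ - 1) (by positivity) (h1.congr fun k => by
        simp only [Function.comp_apply, pInfty]; ring)
    refine h2.trans (EventuallyEq.isEquivalent (Eventually.of_forall fun k => ?_))
    simp only [neg_sub]
    rw [Real.mul_rpow (by positivity) (by positivity), show 2 * κ - 4 = (κ - 2) + (κ - 2) by ring,
      show 2 * κ - 6 = (κ - 3) + (κ - 3) by ring, Real.rpow_add ha, Real.rpow_add hb]
    ring
  · have hi₁ := hA.integrable hP₁ hc hκ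
    have hi₂ := integrable_of_exp ha hP₂ he
    have ha₁ := hA.moment_one_pos hP₁ hc hκ
    have hb : 0 < moment P₂ 1 := moment_pos hP₂ one_ne_zero (by simpa using hi₂) h0
    have hb₂ : 0 < moment P₂ 2 := moment_pos hP₂ two_ne_zero (integrable_sq_of_exp ha hP₂ he) h0
    have hc1 : 0 < cStar1 P₂ β c κ := by unfold cStar1; positivity
    have hc2 : 0 < cStar2 P₂ β c κ := by unfold cStar2; positivity
    have hq := powTail_q_of_exp hP₁ hP₂ hc hκ hA ha he h0 hβ
    have hq0 := q_nonneg hP₁ hP₂ hi₁ hi₂ ha₁ hb hβ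
    have hsum : ∀ d : ℕ, Summable (fun i : ℕ => q P₁ P₂ β i * q P₁ P₂ β (d + i)) := by
      intro d
      obtain ⟨D, hD⟩ := (Metric.isBounded_range_of_tendsto _
        (hq.tendsto_zero (by linarith))).exists_norm_le
      refine Summable.of_nonneg_of_le (fun i => mul_nonneg (hq0 _) (hq0 _)) (fun i => ?_)
        ((hq.summable_abs (by linarith)).mul_right D)
      exact mul_le_mul (le_abs_self _) ((le_abs_self _).trans (hD _ ⟨_, rfl⟩)) (hq0 _)
        (abs_nonneg _)
    -- An equivalence to the zero function would say too much, so `c*_{3,d} > 0` is needed; it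
    -- holds because the tail of `q` is eventually positive.
    have hc3 : ∀ d, 0 < cStar3 P₁ P₂ β d := by
      intro d
      have hpos : ∀ᶠ i in atTop, 0 < q P₁ P₂ β i := by
        filter_upwards [Tendsto.eventually_const_lt hc2 hq] with i hi
        exact pos_of_mul_pos_left hi (by positivity)
      obtain ⟨N, hN⟩ := eventually_atTop.mp hpos
      exact (hsum d).tsum_pos (fun i => mul_nonneg (hq0 _) (hq0 _)) N
        (mul_pos (hN N le_rfl) (hN _ (Nat.le_add_left N d)))
    have hprod : (fun k : ℕ × ℕ => degSum P₁ P₂ β k.1 (k.1 + k.2)) ~[atTop ×ˢ atTop]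
        (fun k : ℕ × ℕ => moment P₂ 1 * cStar1 P₂ β c κ * cStar2 P₂ β c κ *
          (k.1 : ℝ) ^ (2 - κ) * (k.2 : ℝ) ^ (1 - κ)) := by
      have h1 := isEquivalent_of_tendsto_prod (by positivity)
        (tendsto_degSum_prod hP₁ hc hκ hA hb hβ hq (tsum_q hP₁ hP₂ hi₁ hi₂ ha₁ hb hβ))
      simp only [neg_sub] at h1
      simpa only [mul_assoc] using h1
    have hfix : ∀ d : ℕ, (fun k : ℕ => degSum P₁ P₂ β k (k + d)) ~[atTop]
        (fun k : ℕ => cStar1 P₂ β c κ * cStar3 P₁ P₂ β d * (k : ℝ) ^ (2 - κ)) := by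
      intro d
      have h1 := (powTail_degSum hP₁ hc hκ hA hb hβ hq d).isEquivalent
        (mul_pos hc1 (hc3 d)).ne'
      simpa only [neg_sub] using h1
    refine ⟨?_, hsum, hprod, hfix, fun _ => ⟨?_, fun d => ?_⟩⟩
    · simpa only [neg_sub] using hq.isEquivalent hc2.ne'
    · exact IsEquivalent.refl.mul hprod
    · exact IsEquivalent.refl.mul (hfix d)
  · subst hP
    have hb := hA.moment_one_pos hP₂ hc hκ
    set s := moment P₂ 1 * β ^ (-(1 / 2 : ℝ)) * x with hs
    have hq := powTail_q_dirac hP₂ hc hκ hx hA hβ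
    -- For a Poisson variable the second factorial weights give back `s ^ 2` times its law.
    have hlam : ∀ r : ℕ, ((r : ℝ) + 1) * ((r : ℝ) + 2) *
        probLam0 (Measure.dirac x) P₂ β (r + 2) = s ^ 2 * poissonProb s r := by
      intro r
      rw [probLam0, mixedPoisson_dirac, ← hs]
      have h1 := succ_mul_poissonProb s (r + 1)
      have h2 := succ_mul_poissonProb s r
      push_cast at h1
      linear_combination ((r : ℝ) + 1) * h1 + s * h2
    have h1 := (tendsto_light_sum (by linarith) ((summable_poissonProb_mul_rpow s
      (κ - 1 + (κ - 1)))) hq).const_mul (β / (moment P₂ 1 ^ 4 * x ^ 2) * s ^ 2)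
    rw [(hasSum_poissonProb s).tsum_eq] at h1
    have e : β / (moment P₂ 1 ^ 4 * x ^ 2) * s ^ 2 * (1 * (c * (x ^ 2 * moment P₂ 1) ^ (κ - 2)) *
        (c * (x ^ 2 * moment P₂ 1) ^ (κ - 2))) =
        c ^ 2 * x ^ (4 * κ - 8) * moment P₂ 1 ^ (2 * κ - 6) := by
      have e1 : s ^ 2 = moment P₂ 1 ^ 2 * β⁻¹ * x ^ 2 := by
        rw [hs, mul_pow, mul_pow, ← Real.rpow_natCast (β ^ _), ← Real.rpow_mul hβ.le,
          ← Real.rpow_neg_one]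
        norm_num
      have e2 : x ^ (4 * κ - 8) = (x ^ 2) ^ (κ - 2) * (x ^ 2) ^ (κ - 2) := by
        rw [← Real.rpow_add (by positivity), ← Real.rpow_natCast x 2, ← Real.rpow_mul hx.le]
        congr 1; push_cast; ring
      have e3 : moment P₂ 1 ^ (2 * κ - 6) = moment P₂ 1 ^ (κ - 2) * moment P₂ 1 ^ (κ - 2) /
          moment P₂ 1 ^ 2 := by
        rw [← Real.rpow_add hb, ← Real.rpow_natCast (moment P₂ 1) 2, ← Real.rpow_sub hb]
        congr 1; push_cast; ring
      rw [e1, e2, e3, Real.mul_rpow (by positivity) hb.le]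
      field_simp
    rw [e] at h1
    have h2 := isEquivalent_of_tendsto_prod
      (F := fun k => pBeta (Measure.dirac x) P₂ β k.1 k.2)
      (a := κ - 1) (b := κ - 1) (by positivity) (h1.congr fun k => by
        rw [pBeta, degSum, moment_dirac]
        simp only [hlam, mul_assoc, ← Finset.mul_sum])
    refine h2.trans (EventuallyEq.isEquivalent (Eventually.of_forall fun k => ?_))
    simp only [neg_sub]
    rw [Real.mul_rpow (by positivity) (by positivity)]
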